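/- Let $M$ be a connected complex manifold (Hausdorff, second countable) of dimension $n$. Plurisubharmonic (psh) functions on $M$ take values in $[-\infty,\infty)$, and $u\equiv-\infty$ is allowed. A continuous function $u:M\to\mathbb R$ is strictly psh if every point of $M$ has a coordinate neighborhood, with coordinates $z$, on which $u-\varepsilon\|z\|^2$ is psh for some $\varepsilon>0$. A function $u$ on $M$ has a logarithmic pole at $w\in M$ if in the coordinates of some coordinate neighborhood $U$ of $w$ there is a constant $c$ with $u(z)\le\log\|z-w\|+c$ on $U$; it has a strict logarithmic pole at $w$ if for some such $U$ there are constants $c_1,c_2$ with \[\log\|z-w\|+c_1\le u(z)\le\log\|z-w\|+c_2\quad\text{on }U\] (here $\log 0=-\infty$). The pluricomplex Green function is $g_M(z,w)=\sup u(z)$, the supremum being taken over all negative psh functions $u$ on $M$ with a logarithmic pole at $w$. The manifold $M$ is pluri-Greenian if $g_M(\cdot,w)$ has a strict logarithmic pole at $w$ for every $w\in M$. (1) If $M$ has a bounded continuous strictly psh function, then $M$ is pluri-Greenian. (2) Conversely, suppose that for every $w\in M$ there is a negative psh function $v$ on $M$, continuous as a map into $[-\infty,0)$, with a strict logarithmic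 pole at $w$. Then $M$ has a bounded continuous strictly psh function. -/

import Mathlib

open scoped Manifold ContDiff

noncomputable section

/-- The mean value over the circle `|ζ - c| = r` (with respect to normalized arc length) of an
extended-real function `u`: the mean of the positive part minus the mean of the negative part.
For `u` upper semicontinuous with values in `[-∞, ∞)` the first term is finite. -/
def circleMean (u : ℂ → EReal) (c : ℂ) (r : ℝ) : EReal :=
  (MeasureTheory.laverage (MeasureTheory.volume.restrict (Set.Ioc 0 (2 * Real.pi)))
    (fun θ : ℝ => (u (circleMap c r θ)).toENNReal) : EReal) -
  (MeasureTheory.laverage (MeasureTheory.volume.restrict (Set.Ioc 0 (2 * Real.pi)))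
    (fun θ : ℝ => (-u (circleMap c r θ)).toENNReal) : EReal)

/-- `u` is subharmonic on the open set `Ω ⊆ ℂ`, the function `-∞` being allowed: `u` is upper
semicontinuous with values in `[-∞, ∞)` and satisfies the sub-mean value inequality on every
closed disk in `Ω`. -/
structure IsSubharmonicOn (u : ℂ → EReal) (Ω : Set ℂ) : Prop where
  usc : UpperSemicontinuousOn u Ω
  lt_top : ∀ z ∈ Ω, u z < ⊤
  le_circleMean : ∀ (c : ℂ) (r : ℝ), 0 < r → Metric.closedBall c r ⊆ Ω → u c ≤ circleMean u c r

section Manifold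

variable (n : ℕ) {M : Type*} [TopologicalSpace M] [ChartedSpace (EuclideanSpace ℂ (Fin n)) M]

/-- `u` is plurisubharmonic on the open subset `U` of the complex manifold `M`, the function `-∞`
being allowed: `u` is upper semicontinuous with values in `[-∞, ∞)`, and `u ∘ f` is subharmonic
(or `-∞`) for every holomorphic map `f` of the unit disk into `U`. -/
structure IsPSHOn (u : M → EReal) (U : Set M) : Prop where
  usc : UpperSemicontinuousOn u U
  lt_top : ∀ z ∈ U, u z < ⊤
  comp_disk : ∀ f : ℂ → M,
    MDifferentiableOn 𝓘(ℂ, ℂ) 𝓘(ℂ, EuclideanSpace ℂ (Fin n)) f (Metric.ball 0 1) →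
    Set.MapsTo f (Metric.ball 0 1) U → IsSubharmonicOn (u ∘ f) (Metric.ball 0 1)

/-- Plurisubharmonic functions on the whole manifold. -/
def IsPSH (u : M → EReal) : Prop := IsPSHOn n u Set.univ

/-- The holomorphic charts of `M`; their sources are the coordinate neighborhoods. -/
def holoCharts (M : Type*) [TopologicalSpace M] [ChartedSpace (EuclideanSpace ℂ (Fin n)) M] :
    Set (OpenPartialHomeomorph M (EuclideanSpace ℂ (Fin n))) :=
  IsManifold.maximalAtlas 𝓘(ℂ, EuclideanSpace ℂ (Fin n)) ω M

/-- `u` is strictly plurisubharmonic: every point has a coordinate neighborhood on which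
`u - ε ‖z‖ ^ 2` is plurisubharmonic for some `ε > 0`. -/
def IsStrictlyPSH (u : M → EReal) : Prop :=
  ∀ p : M, ∃ φ ∈ holoCharts n M, p ∈ φ.source ∧ ∃ ε : ℝ, 0 < ε ∧
    IsPSHOn n (fun z => u z - ((ε * ‖φ z‖ ^ 2 : ℝ) : EReal)) φ.source

/-- `log ‖z - w‖` in the coordinates `φ`, with value `-∞` at `z = w`. -/
def logDist (φ : OpenPartialHomeomorph M (EuclideanSpace ℂ (Fin n))) (z w : M) : EReal :=
  ENNReal.log ‖φ z - φ w‖ₑ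

/-- `u` has a logarithmic pole at `w`: in some coordinate neighborhood of `w`,
`u(z) ≤ log ‖z - w‖ + c`. -/
def HasLogPole (u : M → EReal) (w : M) : Prop :=
  ∃ φ ∈ holoCharts n M, w ∈ φ.source ∧ ∃ c : ℝ, ∀ z ∈ φ.source, u z ≤ logDist n φ z w + (c : EReal)

/-- `u` has a strict logarithmic pole at `w`: in some coordinate neighborhood of `w`,
`log ‖z - w‖ + c₁ ≤ u(z) ≤ log ‖z - w‖ + c₂`. -/
def HasStrictLogPole (u : M → EReal) (w : M) : Prop :=
  ∃ φ ∈ holoCharts n M, w ∈ φ.source ∧ ∃ c₁ c₂ : ℝ, ∀ z ∈ φ.source,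
    logDist n φ z w + (c₁ : EReal) ≤ u z ∧ u z ≤ logDist n φ z w + (c₂ : EReal)

/-- The pluricomplex Green function `g_M(z, w)`: the supremum at `z` of all negative
plurisubharmonic functions on `M` with a logarithmic pole at `w`. -/
def pluricomplexGreen (z w : M) : EReal :=
  ⨆ u ∈ {u : M → EReal | IsPSH n u ∧ (∀ x, u x < 0) ∧ HasLogPole n u w}, u z

/-- `M` is pluri-Greenian: `g_M(·, w)` has a strict logarithmic pole at every `w`. -/
def IsPluriGreenian (M : Type*) [TopologicalSpace M]
    [ChartedSpace (EuclideanSpace ℂ (Fin n)) M] : Prop :=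
  ∀ w : M, HasStrictLogPole n (fun z => pluricomplexGreen n z w) w

/-- `M` has a bounded continuous strictly plurisubharmonic function. -/
def HasBoundedContinuousStrictlyPSH (M : Type*) [TopologicalSpace M]
    [ChartedSpace (EuclideanSpace ℂ (Fin n)) M] : Prop :=
  ∃ u : M → ℝ, Continuous u ∧ (∃ C : ℝ, ∀ z, |u z| ≤ C) ∧
    IsStrictlyPSH n (fun z => (u z : EReal))

end Manifold

end

/-! Statement (1). Let `u` be bounded, continuous and strictly psh, and work in a coordinate ball at
`w`. The upper bound for the Green function is a Schwarz lemma: on the complex disk through `w` and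
`z`, a negative subharmonic function with a logarithmic pole at the origin is at most `log |ζ|`
(`IsSubharmonicOn.le_log_norm`, `le_logDist_of_hasLogPole`), and this bound does not depend on the
constant in the pole. The lower bound needs a single competitor. The function `logSq (‖z - w‖ / ρ)`
is psh, has the right pole, and is exactly quadratic for `‖z - w‖ ≥ ρ`. Adding `A * (u - ε ‖z - w‖ ^
2)`, which is psh, with `A` chosen so that the quadratic terms cancel, leaves `A * u` outside the
ball of radius `ρ`, so the sum extends psh to all of `M`. It is bounded above, and subtracting a
constant makes it negative.

Statement (2). For a pole function `v` at `w` and large `K`, take `max v (‖z - w‖ ^ 2 - K)` near `w`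
and `max v (-K)` elsewhere. The lower bound at the pole makes `v` win on the overlap, so the pieces
glue to a bounded continuous psh function; where `v < -K` it is `‖z - w‖ ^ 2 - K`, hence strictly
psh near `w` (`exists_psh_strict_near`). Countably many such neighborhoods cover `M`, and a
geometrically weighted sum is strictly psh everywhere.

Both gluings rest on the locality of subharmonicity. `SubMean` replaces extended-real integrals by
continuous majorants. On a circle such a majorant is nearly the real part of an entire function, and
the maximum principle for `u` minus that harmonic function, which needs only some arbitrarily small
circles at each point, gives the inequality on large disks. -/

/-! ### Subharmonic functions in the plane: locality, operations, logarithmic poles. -/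

section Subharmonic

open Metric Set Filter Topology

/-- Continuous functions on a circle are uniformly approximated by real parts of entire functions. -/
lemma exists_differentiable_re_approx {φ : ℂ → ℝ} {c : ℂ} {r ε : ℝ} (hr : 0 < r)
    (hφ : ContinuousOn φ (sphere c r)) (hε : 0 < ε) :
    ∃ h : ℂ → ℂ, Differentiable ℂ h ∧ ∀ z ∈ sphere c r, |(h z).re - φ z| < ε := by
  have : Fact (0 < 2 * Real.pi) := ⟨Real.two_pi_pos⟩
  let e : AddCircle (2 * Real.pi) → ℂ := fun x => c + r * (AddCircle.toCircle x : ℂ)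
  have he : Continuous e := by
    have : Continuous fun x : AddCircle (2 * Real.pi) => (AddCircle.toCircle x : ℂ) :=
      continuous_subtype_val.comp AddCircle.continuous_toCircle
    fun_prop
  have hes : ∀ x, e x ∈ sphere c r := fun x => by
    simp [e, abs_of_pos hr, Circle.norm_coe]
  let f : C(AddCircle (2 * Real.pi), ℂ) :=
    ⟨fun x => (φ (e x) : ℂ), Complex.continuous_ofReal.comp
      (hφ.comp_continuous he hes)⟩
  -- The multiplier `a` carries the induction through complex scalars, since taking real parts is
  -- not complex linear.
  have hspan : ∀ g ∈ Submodule.span ℂ (range (@fourier (2 * Real.pi))), ∀ a : ℂ,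
      ∃ h : ℂ → ℂ, Differentiable ℂ h ∧ ∀ x, (h (e x)).re = (a * g x).re := by
    intro g hg
    induction hg using Submodule.span_induction with
    | mem g hg =>
      obtain ⟨n, rfl⟩ := hg
      intro a
      have hee : ∀ x, (e x - c) / r = (AddCircle.toCircle x : ℂ) := fun x => by
        have : (r : ℂ) ≠ 0 := by exact_mod_cast hr.ne'
        simp only [e]; field_simp; ring
      have hpow : ∀ (k : ℕ) x, ((e x - c) / r) ^ k = fourier (T := 2 * Real.pi) (k : ℤ) x := by
        intro k x
        rw [hee, fourier_apply, AddCircle.toCircle_zsmul]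
        simp
      obtain ⟨k, rfl | rfl⟩ := n.eq_nat_or_neg
      · exact ⟨fun z => a * ((z - c) / r) ^ k, by fun_prop, fun x => by simp only [hpow]⟩
      -- A negative frequency is the conjugate of a positive one on the circle, and conjugation
      -- preserves real parts.
      · refine ⟨fun z => (starRingEnd ℂ) a * ((z - c) / r) ^ k, by fun_prop, fun x => ?_⟩
        simp only [hpow]
        rw [fourier_neg, ← Complex.conj_re]
        simp
    | zero => exact fun a => ⟨0, differentiable_const 0, by simp⟩
    | add g₁ g₂ _ _ h₁ h₂ =>
      intro a
      obtain ⟨u₁, d₁, e₁⟩ := h₁ a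
      obtain ⟨u₂, d₂, e₂⟩ := h₂ a
      exact ⟨u₁ + u₂, d₁.add d₂, fun x => by simp [e₁, e₂, mul_add]⟩
    | smul b g _ h =>
      intro a
      obtain ⟨u, d, e⟩ := h (a * b)
      exact ⟨u, d, fun x => by rw [e]; simp [mul_assoc]⟩
  have hf : f ∈ (Submodule.span ℂ (range (@fourier (2 * Real.pi)))).topologicalClosure := by
    rw [span_fourier_closure_eq_top]; trivial
  obtain ⟨g, hg, hfg⟩ := Metric.mem_closure_iff.1 hf ε hε
  obtain ⟨h, hd, hh⟩ := hspan g hg 1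
  refine ⟨h, hd, fun z hz => ?_⟩
  obtain ⟨x, rfl⟩ : ∃ x, e x = z := by
    have hz' : ‖(z - c) / r‖ = 1 := by
      rw [mem_sphere_iff_norm] at hz
      rw [norm_div, hz, Complex.norm_real, Real.norm_of_nonneg hr.le, div_self hr.ne']
    obtain ⟨x, hx⟩ := (AddCircle.homeomorphCircle Real.two_pi_pos.ne').surjective
      (⟨(z - c) / r, mem_sphere_zero_iff_norm.2 hz'⟩ : Circle)
    refine ⟨x, ?_⟩
    have hx' : (AddCircle.toCircle x : ℂ) = (z - c) / r := by
      have := congrArg (Subtype.val) hx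
      simpa [AddCircle.homeomorphCircle_apply] using this
    have : (r : ℂ) ≠ 0 := by exact_mod_cast hr.ne'
    simp only [e, hx']; field_simp; ring
  rw [hh x, one_mul]
  calc |(g x).re - φ (e x)| = |(g x - f x).re| := by simp [f]
    _ ≤ ‖g x - f x‖ := Complex.abs_re_le_norm _
    _ = dist (f x) (g x) := by rw [dist_comm, dist_eq_norm]
    _ ≤ dist f g := ContinuousMap.dist_apply_le_dist x
    _ < ε := hfg

/-- The sub-mean value inequality on the circle `|ζ - c| = r`, tested against continuous
majorants. -/
def SubMean (u : ℂ → EReal) (c : ℂ) (r : ℝ) : Prop :=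
  ∀ φ : ℂ → ℝ, ContinuousOn φ (sphere c r) → (∀ z ∈ sphere c r, u z ≤ (φ z : EReal)) →
    u c ≤ ((Real.circleAverage φ c r : ℝ) : EReal)

lemma circleMean_mono {u v : ℂ → EReal} {c : ℂ} {r : ℝ} (hr : 0 ≤ r)
    (h : ∀ z ∈ sphere c r, u z ≤ v z) : circleMean u c r ≤ circleMean v c r := by
  have hm : ∀ θ, circleMap c r θ ∈ sphere c r := fun θ => circleMap_mem_sphere c hr θ
  unfold circleMean
  refine EReal.sub_le_sub ?_ ?_ <;> rw [EReal.coe_ennreal_le_coe_ennreal_iff] <;>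
    refine MeasureTheory.laverage_mono_ae (Filter.Eventually.of_forall fun θ => ?_)
  · exact EReal.toENNReal_le_toENNReal (h _ (hm θ))
  · exact EReal.toENNReal_le_toENNReal (EReal.neg_le_neg_iff.2 (h _ (hm θ)))

/-- Both the positive and the negative part have finite integral, so the extended-real difference is
an honest integral. -/
lemma circleMean_coe {φ : ℂ → ℝ} {c : ℂ} {r : ℝ} (hr : 0 ≤ r)
    (hφ : ContinuousOn φ (sphere c r)) :
    circleMean (fun z => (φ z : EReal)) c r = ((Real.circleAverage φ c r : ℝ) : EReal) := by
  have hi : MeasureTheory.Integrable (fun θ => φ (circleMap c r θ))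
      (MeasureTheory.volume.restrict (Ioc 0 (2 * Real.pi))) := by
    have := hφ.circleIntegrable hr
    rw [CircleIntegrable, intervalIntegrable_iff_integrableOn_Ioc_of_le Real.two_pi_pos.le] at this
    exact this
  have h2 : ENNReal.ofReal (2 * Real.pi) ≠ 0 := by simp [Real.pi_pos]
  have f1 := hi.lintegral_lt_top.ne
  have f2 := hi.neg.lintegral_lt_top.ne
  simp only [circleMean, MeasureTheory.laverage_eq, EReal.real_coe_toENNReal, ← EReal.coe_neg,
    MeasureTheory.Measure.restrict_apply_univ, Real.volume_Ioc, sub_zero]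
  rw [Real.circleAverage_def, intervalIntegral.integral_of_le Real.two_pi_pos.le,
    MeasureTheory.integral_eq_lintegral_pos_part_sub_lintegral_neg_part hi]
  simp only [Pi.neg_apply] at f2
  rw [← EReal.coe_ennreal_toReal (ENNReal.div_ne_top f1 h2),
    ← EReal.coe_ennreal_toReal (ENNReal.div_ne_top f2 h2), ← EReal.coe_sub,
    ENNReal.toReal_div, ENNReal.toReal_div, ENNReal.toReal_ofReal Real.two_pi_pos.le]
  congr 1
  rw [smul_eq_mul]
  ring

lemma subMean_of_le_circleMean {u : ℂ → EReal} {c : ℂ} {r : ℝ} (hr : 0 ≤ r)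
    (h : u c ≤ circleMean u c r) : SubMean u c r := fun φ hφ hu => by
  rw [← circleMean_coe hr hφ]
  exact h.trans (circleMean_mono hr hu)

/-- An upper semicontinuous function on a compact set is the decreasing limit of continuous
functions. -/
lemma exists_antitone_continuous_tendsto {X : Type*} [PseudoMetricSpace X] {u : X → EReal}
    {S : Set X} (hS : IsCompact S) (hne : S.Nonempty) (hu : UpperSemicontinuousOn u S)
    (hlt : ∀ z ∈ S, u z < ⊤) :
    ∃ φ : ℕ → X → ℝ, (∀ k, Continuous (φ k)) ∧ Antitone φ ∧
      (∀ k, ∀ z ∈ S, u z ≤ (φ k z : EReal)) ∧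
      ∀ z ∈ S, Tendsto (fun k => (φ k z : EReal)) atTop (𝓝 (u z)) := by
  obtain ⟨B, hB0, hB⟩ : ∃ B : ℝ, 0 ≤ B ∧ ∀ y ∈ S, u y ≤ B := by
    obtain ⟨a, ha, hmax⟩ := hu.exists_isMaxOn hne hS
    obtain ⟨b, hb, -⟩ := EReal.lt_iff_exists_real_btwn.1 (hlt a ha)
    exact ⟨max b 0, le_max_right _ _, fun y hy => (hmax hy).trans
      (hb.le.trans (EReal.coe_le_coe_iff.2 (le_max_left _ _)))⟩
  let g : ℕ → X → ℝ := fun k y => (max (u y) ((-k : ℝ) : EReal)).toReal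
  have hg : ∀ k, ∀ y ∈ S, (g k y : EReal) = max (u y) ((-k : ℝ) : EReal) := fun k y hy =>
    EReal.coe_toReal (max_lt (hlt y hy) (EReal.coe_lt_top _)).ne
      ((EReal.bot_lt_coe _).trans_le (le_max_right _ _)).ne'
  have hgB : ∀ k, ∀ y ∈ S, g k y ≤ B := fun k y hy => by
    rw [← EReal.coe_le_coe_iff, hg k y hy]
    refine max_le (hB y hy) (EReal.coe_le_coe_iff.2 ?_)
    have : (0 : ℝ) ≤ k := k.cast_nonneg
    linarith
  -- Sup-convolution with a cone of slope `k`, hence `k`-Lipschitz. Truncating `u` at `-k` keeps it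
  -- real; raising `k` lowers both the truncation and the cone.
  let φ : ℕ → X → ℝ := fun k z => ⨆ y : S, (g k y - k * dist z y)
  have : Nonempty S := hne.to_subtype
  have hbdd : ∀ (k : ℕ) (z : X), BddAbove (range fun y : S => g k y - k * dist z y) := fun k z => by
    refine ⟨B, ?_⟩
    rintro _ ⟨y, rfl⟩
    have := hgB k y y.2
    have : (0 : ℝ) ≤ k * dist z y := by positivity
    simp only
    linarith
  have hle : ∀ k, ∀ z ∈ S, u z ≤ (φ k z : EReal) := fun k z hz => by
    have h1 : g k z ≤ φ k z := by
      have := le_ciSup (hbdd k z) ⟨z, hz⟩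
      simpa using this
    exact (le_max_left _ _).trans ((hg k z hz).ge.trans (EReal.coe_le_coe_iff.2 h1))
  refine ⟨φ, fun k => ?_, ?_, hle, fun z hz => ?_⟩
  · refine (LipschitzWith.of_le_add_mul (k : NNReal) fun x y => ciSup_le fun w => ?_).continuous
    have h1 := le_ciSup (hbdd k y) w
    have h2 : (k : ℝ) * dist y w ≤ k * (dist x y + dist x w) := by
      gcongr
      rw [dist_comm x y]
      exact dist_triangle _ _ _
    have h3 : g k w - k * dist y w ≤ φ k y := h1
    simp only [NNReal.coe_natCast]
    nlinarith
  · intro k l hkl z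
    refine ciSup_mono (hbdd k z) fun y => ?_
    have hkl' : (k : ℝ) ≤ l := by exact_mod_cast hkl
    have h1 : g l y ≤ g k y := by
      rw [← EReal.coe_le_coe_iff, hg l y y.2, hg k y y.2]
      exact max_le_max le_rfl (EReal.coe_le_coe_iff.2 (neg_le_neg hkl'))
    have h2 : (k : ℝ) * dist z y ≤ l * dist z y := by gcongr
    linarith
  · rw [tendsto_order]
    refine ⟨fun a ha => Eventually.of_forall fun k => ha.trans_le (hle k z hz), fun a ha => ?_⟩
    obtain ⟨b, hb, hba⟩ := EReal.lt_iff_exists_real_btwn.1 ha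
    obtain ⟨δ, hδ, hball⟩ := Metric.mem_nhdsWithin_iff.1 (hu z hz b hb)
    -- The first bound puts the truncated values near `z` below `b`; the second makes the cone
    -- penalty bring points at distance at least `δ` below `b`.
    obtain ⟨N, hN⟩ := exists_nat_ge (max (-b) ((B - b) / δ))
    filter_upwards [eventually_ge_atTop N] with k hk
    refine lt_of_le_of_lt (EReal.coe_le_coe_iff.2 (ciSup_le fun y => ?_)) hba
    have hkN : (N : ℝ) ≤ k := by exact_mod_cast hk
    have hk1 : -b ≤ k := (le_max_left _ _).trans (hN.trans hkN)
    have hk2 : (B - b) / δ ≤ k := (le_max_right _ _).trans (hN.trans hkN)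
    rw [div_le_iff₀ hδ] at hk2
    have hk0 : (0 : ℝ) ≤ k := k.cast_nonneg
    by_cases hy : dist z y < δ
    · have h1 : g k y ≤ b := by
        rw [← EReal.coe_le_coe_iff, hg k y y.2]
        refine max_le (le_of_lt (hball ⟨?_, y.2⟩)) (EReal.coe_le_coe_iff.2 (by linarith))
        rwa [mem_ball, dist_comm]
      have : (0 : ℝ) ≤ k * dist z y := by positivity
      linarith
    · have h1 := hgB k y y.2
      have h2 : (k : ℝ) * δ ≤ k * dist z y := by
        gcongr
        exact not_lt.1 hy
      linarith

/-- For upper semicontinuous functions, the sub-mean value inequality may be tested against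
continuous majorants. -/
lemma SubMean.le_circleMean {u : ℂ → EReal} {c : ℂ} {r : ℝ} (hr : 0 ≤ r)
    (hu : UpperSemicontinuousOn u (sphere c r)) (hlt : ∀ z ∈ sphere c r, u z < ⊤)
    (h : SubMean u c r) : u c ≤ circleMean u c r := by
  obtain ⟨φ, hφ, hanti, hle, hlim⟩ := exists_antitone_continuous_tendsto (isCompact_sphere c r)
    (NormedSpace.sphere_nonempty.2 hr) hu hlt
  have hm : ∀ θ, circleMap c r θ ∈ sphere c r := fun θ => circleMap_mem_sphere c hr θ
  set μ := MeasureTheory.volume.restrict (Ioc 0 (2 * Real.pi)) with hμ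
  have hμ0 : μ univ ≠ 0 := by simp [hμ, Real.pi_pos]
  have hcont : ∀ k, Continuous fun θ => (φ k (circleMap c r θ) : EReal) := fun k =>
    continuous_coe_real_ereal.comp ((hφ k).comp (continuous_circleMap c r))
  have hfin : ∫⁻ θ, (φ 0 (circleMap c r θ) : EReal).toENNReal ∂μ ≠ ⊤ := by
    have : MeasureTheory.Integrable (fun θ => φ 0 (circleMap c r θ)) μ := by
      have := (hφ 0).continuousOn.circleIntegrable (c := c) hr
      rw [CircleIntegrable, intervalIntegrable_iff_integrableOn_Ioc_of_le Real.two_pi_pos.le]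
        at this
      exact this
    simpa [EReal.real_coe_toENNReal] using this.lintegral_lt_top.ne
  have h1 : Tendsto (fun k => ∫⁻ θ, (φ k (circleMap c r θ) : EReal).toENNReal ∂μ) atTop
      (𝓝 (∫⁻ θ, (u (circleMap c r θ)).toENNReal ∂μ)) := by
    refine MeasureTheory.lintegral_tendsto_of_tendsto_of_antitone
      (fun k => (EReal.continuous_toENNReal.comp (hcont k)).aemeasurable) ?_ hfin ?_
    · exact Eventually.of_forall fun θ k l hkl =>
        EReal.toENNReal_le_toENNReal (EReal.coe_le_coe_iff.2 (hanti hkl _))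
    · exact Eventually.of_forall fun θ =>
        (EReal.continuous_toENNReal.tendsto _).comp (hlim _ (hm θ))
  have h2 : Tendsto (fun k => ∫⁻ θ, (-(φ k (circleMap c r θ) : EReal)).toENNReal ∂μ) atTop
      (𝓝 (∫⁻ θ, (-u (circleMap c r θ)).toENNReal ∂μ)) := by
    refine MeasureTheory.lintegral_tendsto_of_tendsto_of_monotone
      (fun k => (EReal.continuous_toENNReal.comp (hcont k).neg).aemeasurable) ?_ ?_
    · exact Eventually.of_forall fun θ k l hkl => EReal.toENNReal_le_toENNReal
        (EReal.neg_le_neg_iff.2 (EReal.coe_le_coe_iff.2 (hanti hkl _)))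
    · exact Eventually.of_forall fun θ =>
        (EReal.continuous_toENNReal.tendsto _).comp ((hlim _ (hm θ)).neg)
  -- With a finite positive part no `∞ - ∞` arises, so subtraction is continuous at the limit.
  have hfin' : ∫⁻ θ, (u (circleMap c r θ)).toENNReal ∂μ ≠ ⊤ :=
    ne_top_of_le_ne_top hfin (MeasureTheory.lintegral_mono fun θ =>
      EReal.toENNReal_le_toENNReal (hle 0 _ (hm θ)))
  have hlim : Tendsto (fun k => circleMean (fun z => (φ k z : EReal)) c r) atTop
      (𝓝 (circleMean u c r)) := by
    simp only [circleMean, MeasureTheory.laverage_eq, sub_eq_add_neg]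
    have hp : ((∫⁻ θ, (u (circleMap c r θ)).toENNReal ∂μ) / μ univ : ENNReal) ≠ ⊤ :=
      ENNReal.div_ne_top hfin' hμ0
    refine (EReal.continuousAt_add (Or.inl ?_) (Or.inl ?_)).tendsto.comp
      (Tendsto.prodMk_nhds ?_ ?_)
    · exact mt EReal.coe_ennreal_eq_top_iff.1 hp
    · exact EReal.coe_ennreal_ne_bot _
    · exact (continuous_coe_ennreal_ereal.tendsto _).comp
        (ENNReal.Tendsto.div_const h1 (Or.inr hμ0))
    · exact ((continuous_coe_ennreal_ereal.tendsto _).comp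
        (ENNReal.Tendsto.div_const h2 (Or.inr hμ0))).neg
  refine ge_of_tendsto hlim (Eventually.of_forall fun k => ?_)
  rw [circleMean_coe hr (hφ k).continuousOn]
  exact h _ (hφ k).continuousOn (hle k)

/-- By continuity, being below `a` at one point means being below it on a whole arc. This supplies
the contradiction in the maximum principle. -/
lemma circleAverage_lt_of_lt {f : ℂ → ℝ} {c q : ℂ} {r a : ℝ} (hr : 0 ≤ r)
    (hf : ContinuousOn f (sphere c r)) (hle : ∀ z ∈ sphere c r, f z ≤ a)
    (hq : q ∈ sphere c r) (hlt : f q < a) : Real.circleAverage f c r < a := by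
  have hcont : Continuous fun θ => a - f (circleMap c r θ) :=
    continuous_const.sub (hf.comp_continuous (continuous_circleMap c r)
      fun θ => circleMap_mem_sphere c hr θ)
  obtain ⟨θ, hθ, hθq⟩ : ∃ θ ∈ Ioc 0 (2 * Real.pi), circleMap c r θ = q := by
    have := image_circleMap_Ioc c r
    rw [abs_of_nonneg hr] at this
    rwa [← this] at hq
  have hpos : 0 < ∫ θ in (0 : ℝ)..2 * Real.pi, (a - f (circleMap c r θ)) := by
    refine intervalIntegral.integral_pos Real.two_pi_pos hcont.continuousOn
      (fun θ _ => sub_nonneg.2 (hle _ (circleMap_mem_sphere c hr θ)))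
      ⟨θ, ⟨hθ.1.le, hθ.2⟩, by rw [hθq]; linarith⟩
  have hsub : Real.circleAverage (fun z => a - f z) c r = a - Real.circleAverage f c r := by
    rw [Real.circleAverage_fun_sub (by simp) (hf.circleIntegrable hr), Real.circleAverage_const]
  have : 0 < Real.circleAverage (fun z => a - f z) c r := by
    rw [Real.circleAverage_def, smul_eq_mul]
    have := Real.pi_pos
    positivity
  linarith

/-- The maximum principle on a closed disk. -/
lemma le_of_local_subMean {v : ℂ → EReal} {c : ℂ} {R : ℝ} {a : ℝ}
    (hv : UpperSemicontinuousOn v (closedBall c R)) (hlt : ∀ z ∈ closedBall c R, v z < ⊤)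
    (hsphere : ∀ z ∈ sphere c R, v z ≤ a)
    (hsub : ∀ p ∈ ball c R, ∃ᶠ r in 𝓝[>] (0 : ℝ), SubMean v p r) :
    ∀ z ∈ closedBall c R, v z ≤ a := by
  intro z₀ hz₀
  by_contra hcon
  obtain ⟨m, hm, hmax⟩ := hv.exists_isMaxOn ⟨z₀, hz₀⟩ (isCompact_closedBall c R)
  have hma : (a : EReal) < v m := (not_le.1 hcon).trans_le (hmax hz₀)
  have hK := hv.isCompact_inter_preimage_Ici (isCompact_closedBall c R) (v m)
  -- Among the maximum points take one farthest from the center: every small circle around it leaves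
  -- the maximum set, so a single good radius suffices and no connectedness argument is needed.
  obtain ⟨p, ⟨hp, hpm⟩, hfar⟩ := hK.exists_isMaxOn ⟨m, hm, le_refl (v m)⟩
    (continuous_id.dist continuous_const : Continuous fun z => dist z c).continuousOn
  have hpm' : v p = v m := le_antisymm (hmax hp) hpm
  have hpb : p ∈ ball c R := by
    refine lt_of_le_of_ne (mem_closedBall.1 hp) fun h => ?_
    exact absurd (hsphere p h) (not_le.2 (by rwa [hpm']))
  obtain ⟨A, hA⟩ : ∃ A : ℝ, v m = A := ⟨(v m).toReal, (EReal.coe_toReal (hlt m hm).ne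
    ((EReal.bot_lt_coe a).trans hma).ne').symm⟩
  have hsmall : ∀ᶠ r in 𝓝[>] (0 : ℝ), 0 < r ∧ closedBall p r ⊆ ball c R := by
    obtain ⟨ε, hε, hsub⟩ := Metric.isOpen_iff.1 isOpen_ball p hpb
    filter_upwards [Ioo_mem_nhdsGT hε] with r hr
    exact ⟨hr.1, (closedBall_subset_ball hr.2).trans hsub⟩
  obtain ⟨r, hrsub, hr, hrb⟩ := ((hsub p hpb).and_eventually hsmall).exists
  obtain ⟨q, hqs, hqd⟩ : ∃ q ∈ sphere p r, dist p c < dist q c := by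
    by_cases hpc : p = c
    · obtain ⟨q, hq⟩ := NormedSpace.sphere_nonempty (x := p).2 hr.le
      refine ⟨q, hq, ?_⟩
      rw [← hpc, hq, dist_self]
      exact hr
    · have hn : 0 < ‖p - c‖ := norm_pos_iff.2 (sub_ne_zero.2 hpc)
      have hn' : (‖p - c‖ : ℂ) ≠ 0 := by exact_mod_cast hn.ne'
      refine ⟨p + (r / ‖p - c‖ : ℝ) * (p - c), ?_, ?_⟩
      · rw [mem_sphere_iff_norm, add_sub_cancel_left, norm_mul, Complex.norm_real,
          Real.norm_of_nonneg (by positivity)]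
        field_simp
      · rw [dist_eq_norm, dist_eq_norm]
        have : p + (r / ‖p - c‖ : ℝ) * (p - c) - c = ((1 + r / ‖p - c‖ : ℝ) : ℂ) * (p - c) := by
          push_cast; ring
        rw [this, norm_mul, Complex.norm_real, Real.norm_of_nonneg (by positivity)]
        have : 0 < r / ‖p - c‖ := by positivity
        nlinarith
  have hsc : sphere p r ⊆ closedBall c R :=
    (sphere_subset_closedBall.trans hrb).trans ball_subset_closedBall
  have hqA : v q < A := by
    rw [← hA]
    refine not_le.1 fun h => ?_
    exact absurd (hfar ⟨hsc hqs, h⟩) (not_le.2 hqd)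
  obtain ⟨b, hqb, hbA⟩ := EReal.lt_iff_exists_real_btwn.1 hqA
  have hbA' : b < A := EReal.coe_lt_coe_iff.1 hbA
  obtain ⟨δ, hδ, hball⟩ := Metric.mem_nhdsWithin_iff.1 (hv q (hsc hqs) b hqb)
  -- A continuous majorant of `v`: the maximum `A`, lowered by a tent to `b` at `q`, near which `v <
  -- b`.
  let φ : ℂ → ℝ := fun z => A - (A - b) * max 0 (1 - dist z q / δ)
  have hφ : Continuous φ := by fun_prop
  have hφA : ∀ z, φ z ≤ A := fun z => by
    have : 0 ≤ (A - b) * max 0 (1 - dist z q / δ) :=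
      mul_nonneg (by linarith) (le_max_left _ _)
    simp only [φ]; linarith
  have hmaj : ∀ z ∈ sphere p r, v z ≤ (φ z : EReal) := fun z hz => by
    by_cases hzq : dist z q < δ
    · refine (le_of_lt (hball ⟨hzq, hsc hz⟩ : v z < b)).trans (EReal.coe_le_coe_iff.2 ?_)
      have h1 : max 0 (1 - dist z q / δ) ≤ 1 := max_le zero_le_one (by
        have : 0 ≤ dist z q / δ := by positivity
        linarith)
      simp only [φ]
      nlinarith
    · have : max 0 (1 - dist z q / δ) = 0 := max_eq_left (by
        have := (one_le_div hδ).2 (not_lt.1 hzq)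
        linarith)
      have h2 : φ z = A := by simp [φ, this]
      rw [h2, ← hA]
      exact hmax (hsc hz)
  have hφq : φ q < A := by
    simp [φ]; linarith
  have := hrsub φ hφ.continuousOn hmaj
  rw [hpm', hA, EReal.coe_le_coe_iff] at this
  exact absurd (circleAverage_lt_of_lt hr.le hφ.continuousOn (fun z _ => hφA z) hqs hφq)
    (not_lt.2 this)

lemma EReal.add_coe_le_coe_iff {u : EReal} {x a : ℝ} :
    u + (x : EReal) ≤ (a : EReal) ↔ u ≤ ((a - x : ℝ) : EReal) := by
  induction u with
  | bot => simp
  | top => simp [-EReal.coe_sub]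
  | coe u =>
    rw [← EReal.coe_add, EReal.coe_le_coe_iff, EReal.coe_le_coe_iff]
    exact _root_.le_sub_iff_add_le.symm

lemma EReal.add_coe_lt_top {u : EReal} {x : ℝ} (h : u < ⊤) : u + (x : EReal) < ⊤ :=
  EReal.add_lt_top h.ne (EReal.coe_ne_top x)

lemma UpperSemicontinuousOn.add_coe {X : Type*} [TopologicalSpace X] {u : X → EReal}
    {g : X → ℝ} {S : Set X} (hu : UpperSemicontinuousOn u S) (hg : ContinuousOn g S) :
    UpperSemicontinuousOn (fun z => u z + (g z : EReal)) S :=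
  hu.add' (continuous_coe_real_ereal.comp_continuousOn hg).upperSemicontinuousOn
    fun _ _ => EReal.continuousAt_add (Or.inr (EReal.coe_ne_bot _)) (Or.inr (EReal.coe_ne_top _))

/-- A continuous summand moves to the majorant side, so no sums of extended-real integrals appear.
-/
lemma SubMean.add_coe {u : ℂ → EReal} {g : ℂ → ℝ} {c : ℂ} {r : ℝ} (hr : 0 ≤ r)
    (hu : SubMean u c r) (hg : ContinuousOn g (sphere c r))
    (hgc : g c ≤ Real.circleAverage g c r) :
    SubMean (fun z => u z + (g z : EReal)) c r := fun φ hφ hle => by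
  have := hu (fun z => φ z - g z) (hφ.sub hg) fun z hz => EReal.add_coe_le_coe_iff.1 (hle z hz)
  rw [Real.circleAverage_fun_sub (hφ.circleIntegrable hr) (hg.circleIntegrable hr)] at this
  refine EReal.add_coe_le_coe_iff.2 (this.trans (EReal.coe_le_coe_iff.2 ?_))
  linarith

lemma SubMean.congr {u v : ℂ → EReal} {c : ℂ} {r : ℝ} (hr : 0 ≤ r)
    (hu : SubMean u c r) (h : ∀ z ∈ closedBall c r, u z = v z) : SubMean v c r :=
  fun φ hφ hle => by
    rw [← h c (mem_closedBall_self hr)]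
    exact hu φ hφ fun z hz => (h z (sphere_subset_closedBall hz)).trans_le (hle z hz)

lemma circleAverage_re {h : ℂ → ℂ} {c : ℂ} {r : ℝ} (hr : 0 ≤ r)
    (hh : ∀ z ∈ closedBall c r, DifferentiableAt ℂ h z) :
    Real.circleAverage (fun z => (h z).re) c r = (h c).re := by
  have hc : ContinuousOn h (closedBall c r) := fun z hz =>
    (hh z hz).continuousAt.continuousWithinAt
  have h1 : Real.circleAverage h c r = h c :=
    circleAverage_of_differentiable_on_off_countable (countable_empty)
      (by rwa [abs_of_nonneg hr]) fun z hz => by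
        rw [abs_of_nonneg hr] at hz
        exact hh z (ball_subset_closedBall hz.1)
  have h2 := Complex.reCLM.circleAverage_comp_comm
    ((hc.mono sphere_subset_closedBall).circleIntegrable hr)
  rw [h1] at h2
  exact h2

lemma eventually_pos_and_closedBall_subset {Ω : Set ℂ} (hΩ : IsOpen Ω) {c : ℂ} (hc : c ∈ Ω) :
    ∀ᶠ r in 𝓝[>] (0 : ℝ), 0 < r ∧ closedBall c r ⊆ Ω := by
  obtain ⟨ε, hε, hsub⟩ := Metric.isOpen_iff.1 hΩ c hc
  filter_upwards [Ioo_mem_nhdsGT hε] with r hr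
  exact ⟨hr.1, (closedBall_subset_ball hr.2).trans hsub⟩

/-- Subharmonicity is a local property. -/
theorem isSubharmonicOn_of_frequently_subMean {u : ℂ → EReal} {Ω : Set ℂ}
    (hu : UpperSemicontinuousOn u Ω) (hlt : ∀ z ∈ Ω, u z < ⊤)
    (hsub : ∀ p ∈ Ω, ∃ᶠ r in 𝓝[>] (0 : ℝ), SubMean u p r) : IsSubharmonicOn u Ω := by
  refine ⟨hu, hlt, fun c R hR hcR => ?_⟩
  refine SubMean.le_circleMean hR.le (hu.mono (sphere_subset_closedBall.trans hcR))
    (fun z hz => hlt z (hcR (sphere_subset_closedBall hz))) fun φ hφ hle => ?_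
  have key : ∀ ε : ℝ, 0 < ε → u c ≤ ((Real.circleAverage φ c R + 2 * ε : ℝ) : EReal) := by
    intro ε hε
    obtain ⟨h, hd, hh⟩ := exists_differentiable_re_approx hR hφ hε
    have hc : Continuous fun z => (h z).re := Complex.continuous_re.comp hd.continuous
    -- On the boundary circle `u ≤ φ ≤ Re h + ε`; subtracting the harmonic function preserves the
    -- local inequality, so the bound reaches the center.
    have hv := le_of_local_subMean (v := fun z => u z + ((-(h z).re : ℝ) : EReal)) (a := ε)
      ((hu.mono hcR).add_coe hc.neg.continuousOn)
      (fun z hz => EReal.add_coe_lt_top (hlt z (hcR hz)))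
      (fun z hz => by
        refine EReal.add_coe_le_coe_iff.2 ((hle z hz).trans (EReal.coe_le_coe_iff.2 ?_))
        have := (abs_lt.1 (hh z hz)).1
        linarith)
      (fun p hp => by
        refine ((hsub p (hcR (ball_subset_closedBall hp))).and_eventually
          self_mem_nhdsWithin).mono ?_
        rintro r ⟨hr, hr0⟩
        have hr0' : 0 ≤ r := le_of_lt hr0
        refine hr.add_coe hr0' hc.neg.continuousOn ?_
        have := circleAverage_re (h := fun z => -h z) (c := p) hr0' fun z _ => (hd z).neg
        simpa using this.ge)
      c (mem_closedBall_self hR.le)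
    refine (EReal.add_coe_le_coe_iff.1 hv).trans (EReal.coe_le_coe_iff.2 ?_)
    have h1 := circleAverage_re (c := c) hR.le fun z _ => hd z
    have h2 : Real.circleAverage (fun z => (h z).re) c R ≤
        Real.circleAverage (fun z => φ z + ε) c R := by
      refine Real.circleAverage_mono (hc.continuousOn.circleIntegrable hR.le)
        ((hφ.add continuousOn_const).circleIntegrable hR.le) fun z hz => ?_
      rw [abs_of_pos hR] at hz
      have := (abs_lt.1 (hh z hz)).2
      linarith
    rw [Real.circleAverage_fun_add (hφ.circleIntegrable hR.le) (by simp),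
      Real.circleAverage_const] at h2
    linarith
  refine le_of_forall_gt_imp_ge_of_dense fun b hb => ?_
  obtain ⟨x, hx, hxb⟩ := EReal.lt_iff_exists_real_btwn.1 hb
  rw [EReal.coe_lt_coe_iff] at hx
  have := key ((x - Real.circleAverage φ c R) / 2) (by linarith)
  refine this.trans (le_trans (EReal.coe_le_coe_iff.2 ?_) hxb.le)
  linarith

lemma IsSubharmonicOn.subMean {u : ℂ → EReal} {Ω : Set ℂ} (hu : IsSubharmonicOn u Ω) {c : ℂ}
    {r : ℝ} (hr : 0 < r) (hc : closedBall c r ⊆ Ω) : SubMean u c r :=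
  subMean_of_le_circleMean hr.le (hu.le_circleMean c r hr hc)

/-- A function supported from below at `c` by the real part of a holomorphic function satisfies the
sub-mean value inequality on small circles around `c`. -/
lemma eventually_subMean_of_re_le {u : ℂ → EReal} {c : ℂ} {h : ℂ → ℂ}
    (hd : ∀ᶠ z in 𝓝 c, DifferentiableAt ℂ h z) (hle : ∀ᶠ z in 𝓝 c, ((h z).re : EReal) ≤ u z)
    (hc : u c = ((h c).re : EReal)) : ∀ᶠ r in 𝓝[>] (0 : ℝ), SubMean u c r := by
  obtain ⟨ε, hε, hball⟩ := Metric.eventually_nhds_iff_ball.1 (hd.and hle)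
  filter_upwards [Ioo_mem_nhdsGT hε] with r hr φ hφ hφu
  have hsub : closedBall c r ⊆ ball c ε := closedBall_subset_ball hr.2
  have hdr : ∀ z ∈ closedBall c r, DifferentiableAt ℂ h z := fun z hz => (hball z (hsub hz)).1
  rw [hc, EReal.coe_le_coe_iff, ← circleAverage_re hr.1.le hdr]
  have hcont : ContinuousOn (fun z => (h z).re) (sphere c r) := fun z hz =>
    (Complex.continuous_re.continuousAt.comp
      (hdr z (sphere_subset_closedBall hz)).continuousAt).continuousWithinAt
  refine Real.circleAverage_mono (hcont.circleIntegrable hr.1.le) (hφ.circleIntegrable hr.1.le)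
    fun z hz => ?_
  rw [abs_of_pos hr.1] at hz
  exact EReal.coe_le_coe_iff.1
    ((hball z (hsub (sphere_subset_closedBall hz))).2.trans (hφu z hz))

/-- A function equal to `-∞` at `c` satisfies the sub-mean value inequality at `c`. -/
lemma subMean_of_eq_bot {u : ℂ → EReal} {c : ℂ} (hc : u c = ⊥) (r : ℝ) : SubMean u c r :=
  fun _ _ _ => hc ▸ bot_le

lemma IsSubharmonicOn.add_coe {u : ℂ → EReal} {g : ℂ → ℝ} {Ω : Set ℂ} (hΩ : IsOpen Ω)
    (hu : IsSubharmonicOn u Ω) (hg : IsSubharmonicOn (fun z => (g z : EReal)) Ω)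
    (hgc : ContinuousOn g Ω) : IsSubharmonicOn (fun z => u z + (g z : EReal)) Ω := by
  refine isSubharmonicOn_of_frequently_subMean (hu.usc.add_coe hgc)
    (fun z hz => EReal.add_coe_lt_top (hu.lt_top z hz)) fun p hp => Eventually.frequently ?_
  filter_upwards [eventually_pos_and_closedBall_subset hΩ hp] with r hr
  have hs := (sphere_subset_closedBall.trans hr.2)
  refine (hu.subMean hr.1 hr.2).add_coe hr.1.le (hgc.mono hs) ?_
  exact EReal.coe_le_coe_iff.1
    (hg.subMean hr.1 hr.2 g (hgc.mono hs) fun z _ => le_rfl)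

lemma IsSubharmonicOn.max {u v : ℂ → EReal} {Ω : Set ℂ} (hΩ : IsOpen Ω)
    (hu : IsSubharmonicOn u Ω) (hv : IsSubharmonicOn v Ω) :
    IsSubharmonicOn (fun z => max (u z) (v z)) Ω := by
  refine isSubharmonicOn_of_frequently_subMean (hu.usc.sup hv.usc)
    (fun z hz => max_lt (hu.lt_top z hz) (hv.lt_top z hz)) fun p hp => Eventually.frequently ?_
  filter_upwards [eventually_pos_and_closedBall_subset hΩ hp] with r hr φ hφ hle
  exact max_le
    (hu.subMean hr.1 hr.2 φ hφ fun z hz => (le_max_left _ _).trans (hle z hz))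
    (hv.subMean hr.1 hr.2 φ hφ fun z hz => (le_max_right _ _).trans (hle z hz))

lemma IsSubharmonicOn.const_mul {g : ℂ → ℝ} {Ω : Set ℂ} (hΩ : IsOpen Ω) {a : ℝ} (ha : 0 < a)
    (hg : IsSubharmonicOn (fun z => (g z : EReal)) Ω)
    (hgc : ContinuousOn g Ω) : IsSubharmonicOn (fun z => ((a * g z : ℝ) : EReal)) Ω := by
  have hac : ContinuousOn (fun z => a * g z) Ω := continuousOn_const.mul hgc
  refine isSubharmonicOn_of_frequently_subMean
    (continuous_coe_real_ereal.comp_continuousOn hac).upperSemicontinuousOn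
    (fun z _ => EReal.coe_lt_top _) fun p hp => Eventually.frequently ?_
  filter_upwards [eventually_pos_and_closedBall_subset hΩ hp] with r hr φ hφ hle
  have h1 := hg.subMean hr.1 hr.2 (fun z => a⁻¹ * φ z) (continuousOn_const.mul hφ) fun z hz => by
    rw [EReal.coe_le_coe_iff, inv_mul_eq_div, le_div_iff₀ ha, mul_comm]
    exact EReal.coe_le_coe_iff.1 (hle z hz)
  have h2 : Real.circleAverage (fun z => a⁻¹ * φ z) p r = a⁻¹ * Real.circleAverage φ p r :=
    Real.circleAverage_fun_smul (a := a⁻¹) (f := φ)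
  rw [h2, EReal.coe_le_coe_iff, inv_mul_eq_div, le_div_iff₀ ha, mul_comm] at h1
  exact EReal.coe_le_coe_iff.2 h1

/-- Uniform limits of real-valued subharmonic functions are subharmonic. -/
lemma isSubharmonicOn_of_uniform_approx {g : ℂ → ℝ} {Ω : Set ℂ} (hΩ : IsOpen Ω)
    (hgc : ContinuousOn g Ω)
    (h : ∀ ε > 0, ∃ f : ℂ → ℝ, IsSubharmonicOn (fun z => (f z : EReal)) Ω ∧
      ∀ z ∈ Ω, |g z - f z| ≤ ε) : IsSubharmonicOn (fun z => (g z : EReal)) Ω := by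
  refine isSubharmonicOn_of_frequently_subMean
    (continuous_coe_real_ereal.comp_continuousOn hgc).upperSemicontinuousOn
    (fun z _ => EReal.coe_lt_top _) fun p hp => Eventually.frequently ?_
  filter_upwards [eventually_pos_and_closedBall_subset hΩ hp] with r hr φ hφ hle
  refine EReal.coe_le_coe_iff.2 (le_of_forall_pos_le_add fun ε hε => ?_)
  obtain ⟨f, hf, hfg⟩ := h (ε / 2) (half_pos hε)
  have h1 := hf.subMean hr.1 hr.2 (fun z => φ z + ε / 2) (hφ.add continuousOn_const) fun z hz => by
    have h2 := abs_le.1 (hfg z (hr.2 (sphere_subset_closedBall hz)))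
    have h3 := EReal.coe_le_coe_iff.1 (hle z hz)
    exact EReal.coe_le_coe_iff.2 (by linarith)
  rw [Real.circleAverage_fun_add (hφ.circleIntegrable hr.1.le) (by simp),
    Real.circleAverage_const, EReal.coe_le_coe_iff] at h1
  have h2 := abs_le.1 (hfg p hp)
  linarith

/-- Harmonicity of `log |z|` off the origin. Equality is needed because the logarithm enters below
with a negative coefficient. -/
lemma eventually_circleAverage_log_norm {c : ℂ} (hc : c ≠ 0) :
    ∀ᶠ r in 𝓝[>] (0 : ℝ), Real.circleAverage (fun z => Real.log ‖z‖) c r = Real.log ‖c‖ := by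
  filter_upwards [eventually_pos_and_closedBall_subset isOpen_compl_singleton
    (mem_compl_singleton_iff.2 hc)] with r hr
  refine AnalyticOnNhd.circleAverage_log_norm_of_ne_zero (g := fun z => z)
    analyticOnNhd_id fun u hu => ?_
  rw [abs_of_pos hr.1] at hu
  exact hr.2 hu

/-- A negative subharmonic function on the unit disk with a logarithmic pole at the origin is
bounded above by `log |ζ|`. -/
theorem IsSubharmonicOn.le_log_norm {u : ℂ → EReal} (hu : IsSubharmonicOn u (ball 0 1))
    (hneg : ∀ z ∈ ball (0 : ℂ) 1, u z ≤ 0) {C : ℝ}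
    (hpole : ∀ᶠ z in 𝓝[≠] (0 : ℂ), u z ≤ ((Real.log ‖z‖ + C : ℝ) : EReal))
    {z₀ : ℂ} (hz₀ : z₀ ∈ ball (0 : ℂ) 1) (hne : z₀ ≠ 0) :
    u z₀ ≤ ((Real.log ‖z₀‖ : ℝ) : EReal) := by
  have hz1 : ‖z₀‖ < 1 := by simpa using hz₀
  -- Subtracting only `(1 - δ) log |z|` leaves `δ log |z|`, which forces the value `-∞` at the
  -- origin and makes the difference upper semicontinuous there. On `|z| = ρ` the bound is `u ≤ 0`.
  have key : ∀ δ ∈ Ioo (0 : ℝ) 1, ∀ ρ ∈ Ioo ‖z₀‖ 1,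
      u z₀ ≤ (((1 - δ) * (Real.log ‖z₀‖ - Real.log ρ) : ℝ) : EReal) := by
    intro δ hδ ρ hρ
    have hρ0 : 0 < ρ := (norm_nonneg _).trans_lt hρ.1
    let g : ℂ → ℝ := fun z => -(1 - δ) * Real.log ‖z‖
    have hgc : ∀ z ≠ 0, ContinuousAt g z := fun z hz =>
      continuousAt_const.mul (continuousAt_id.norm.log (norm_ne_zero_iff.2 hz))
    let v : ℂ → EReal := fun z => if z = 0 then ⊥ else u z + (g z : EReal)
    have hsub : closedBall (0 : ℂ) ρ ⊆ ball 0 1 := closedBall_subset_ball hρ.2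
    have hv0 : v 0 = ⊥ := if_pos rfl
    have hvne : ∀ z ≠ 0, v z = u z + (g z : EReal) := fun z hz => if_neg hz
    have husc : UpperSemicontinuousOn v (closedBall 0 ρ) := by
      intro z hz
      by_cases h0 : z = 0
      · subst h0
        intro y hy
        rw [hv0] at hy
        refine mem_nhdsWithin_of_mem_nhds ?_
        obtain ⟨b, hb, hby⟩ := EReal.lt_iff_exists_real_btwn.1 hy
        have hlog : ∀ᶠ z in 𝓝[≠] (0 : ℂ), Real.log ‖z‖ < (b - C) / δ :=
          (Real.tendsto_log_nhdsNE_zero.comp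
            (tendsto_norm_nhdsNE_zero.mono_right (nhdsWithin_mono _ fun x hx => ne_of_gt hx)))
              |>.eventually_lt_atBot _
        have := eventually_nhdsWithin_iff.1 (hpole.and hlog)
        filter_upwards [this] with z hz
        by_cases h0 : z = 0
        · rw [h0, hv0]; exact hy
        · obtain ⟨h1, h2⟩ := hz h0
          rw [hvne z h0]
          refine lt_of_le_of_lt (EReal.add_coe_le_coe_iff.2
            (h1.trans (EReal.coe_le_coe_iff.2 (?_ : _ ≤ b - g z)))) hby
          rw [lt_div_iff₀ hδ.1] at h2
          simp only [g]
          linarith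
      · have h1 : UpperSemicontinuousOn (fun z => u z + (g z : EReal)) (ball 0 1 ∩ {0}ᶜ) :=
          (hu.usc.mono inter_subset_left).add_coe fun z hz => (hgc z hz.2).continuousWithinAt
        have h2 := h1 z ⟨hsub hz, h0⟩
        intro y hy
        have h3 := h2 y (by rw [hvne z h0] at hy; exact hy)
        have h4 : ball (0 : ℂ) 1 ∩ {0}ᶜ ∈ 𝓝 z :=
          (isOpen_ball.inter isOpen_compl_singleton).mem_nhds ⟨hsub hz, h0⟩
        rw [nhdsWithin_eq_nhds.2 h4] at h3
        refine mem_nhdsWithin_of_mem_nhds ?_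
        filter_upwards [h3, h4] with x hx hx4
        rwa [hvne x hx4.2]
    have hvlt : ∀ z ∈ closedBall (0 : ℂ) ρ, v z < ⊤ := fun z hz => by
      by_cases h0 : z = 0
      · rw [h0, hv0]; exact bot_lt_top
      · rw [hvne z h0]; exact EReal.add_coe_lt_top (hu.lt_top z (hsub hz))
    have hvs : ∀ z ∈ sphere (0 : ℂ) ρ, v z ≤ ((-(1 - δ) * Real.log ρ : ℝ) : EReal) :=
      fun z hz => by
        have hzρ : ‖z‖ = ρ := mem_sphere_zero_iff_norm.1 hz
        have h0 : z ≠ 0 := norm_pos_iff.1 (hzρ ▸ hρ0)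
        rw [hvne z h0]
        refine EReal.add_coe_le_coe_iff.2
          ((hneg z (hsub (sphere_subset_closedBall hz))).trans (EReal.coe_le_coe_iff.2 ?_))
        simp [g, hzρ]
    have hmax := le_of_local_subMean husc hvlt hvs (fun p hp => Eventually.frequently (by
      by_cases h0 : p = 0
      · exact Eventually.of_forall fun r => subMean_of_eq_bot (h0 ▸ hv0) r
      · filter_upwards [eventually_pos_and_closedBall_subset
          (isOpen_ball.inter isOpen_compl_singleton)
          (⟨hsub (ball_subset_closedBall hp), h0⟩ : p ∈ ball (0 : ℂ) 1 ∩ {0}ᶜ),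
          eventually_circleAverage_log_norm h0] with r hr hlog
        have hgs : ContinuousOn g (sphere p r) := fun z hz =>
          (hgc z (hr.2 (sphere_subset_closedBall hz)).2).continuousWithinAt
        have hga : g p ≤ Real.circleAverage g p r := by
          have : Real.circleAverage g p r =
              -(1 - δ) * Real.circleAverage (fun z => Real.log ‖z‖) p r :=
            Real.circleAverage_fun_smul (a := -(1 - δ)) (f := fun z : ℂ => Real.log ‖z‖)
          rw [this, hlog]
        exact ((hu.subMean hr.1 (hr.2.trans inter_subset_left)).add_coe hr.1.le hgs hga).congr
          hr.1.le fun z hz => (hvne z (hr.2 hz).2).symm)) z₀ (by simpa using hρ.1.le)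
    rw [hvne z₀ hne] at hmax
    refine (EReal.add_coe_le_coe_iff.1 hmax).trans (EReal.coe_le_coe_iff.2 (le_of_eq ?_))
    simp only [g]; ring
  refine EReal.le_of_forall_lt_iff_le.1 fun b hb => ?_
  rw [EReal.coe_lt_coe_iff] at hb
  -- Both losses are removed together, with `δ = t` and `ρ = 1 - t`.
  have hlim : Tendsto (fun t : ℝ => (1 - t) * (Real.log ‖z₀‖ - Real.log (1 - t))) (𝓝[>] 0)
      (𝓝 (Real.log ‖z₀‖)) := by
    have : ContinuousAt (fun t : ℝ => (1 - t) * (Real.log ‖z₀‖ - Real.log (1 - t))) 0 := by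
      refine ContinuousAt.mul (by fun_prop) (continuousAt_const.sub (ContinuousAt.log ?_ ?_))
      · fun_prop
      · norm_num
    simpa using this.tendsto.mono_left nhdsWithin_le_nhds
  obtain ⟨t, ht, ht1⟩ := ((hlim.eventually_lt_const hb).and
    (Ioo_mem_nhdsGT (sub_pos.2 hz1))).exists
  have h0 := norm_nonneg z₀
  have ht2 := ht1.2
  exact (key t ⟨ht1.1, by linarith⟩ (1 - t) ⟨by linarith, by linarith [ht1.1]⟩).trans
    (EReal.coe_le_coe_iff.2 ht.le)

/-- Rescaling of the sub-mean value inequality. -/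
lemma SubMean.of_comp_affine {u : ℂ → EReal} {p : ℂ} {ρ s : ℝ} (hρ : 0 < ρ)
    (h : SubMean (fun ζ => u (p + ρ * ζ)) 0 s) : SubMean u p (ρ * s) := fun φ hφ hle => by
  have hmaps : ∀ ζ ∈ sphere (0 : ℂ) s, p + ρ * ζ ∈ sphere p (ρ * s) := fun ζ hζ => by
    rw [mem_sphere_zero_iff_norm] at hζ
    simp [hζ, abs_of_pos hρ]
  have h1 := h (fun ζ => φ (p + ρ * ζ)) (hφ.comp (by fun_prop) hmaps)
    fun ζ hζ => hle _ (hmaps ζ hζ)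
  have h2 : Real.circleAverage (fun ζ => φ (p + ρ * ζ)) 0 s = Real.circleAverage φ p (ρ * s) := by
    simp only [Real.circleAverage_def, circleMap, Complex.ofReal_mul, zero_add, mul_assoc]
  rw [h2] at h1
  simpa using h1

end Subharmonic

/-! ### Psh functions on manifolds: locality, operations, functions of charts. -/

section Psh

open Metric Set Filter Topology

variable {n : ℕ} {M : Type*} [TopologicalSpace M] [ChartedSpace (EuclideanSpace ℂ (Fin n)) M]

lemma IsPSHOn.mono {u : M → EReal} {U V : Set M} (h : IsPSHOn n u U) (hVU : V ⊆ U) :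
    IsPSHOn n u V :=
  ⟨h.usc.mono hVU, fun z hz => h.lt_top z (hVU hz),
    fun f hf hm => h.comp_disk f hf (hm.mono_right hVU)⟩

lemma IsPSHOn.congr {u v : M → EReal} {U : Set M} (h : IsPSHOn n u U) (huv : EqOn u v U) :
    IsPSHOn n v U := by
  have husc : UpperSemicontinuousOn v U := fun z hz => by
    intro y hy
    rw [← huv hz] at hy
    filter_upwards [h.usc z hz y hy, self_mem_nhdsWithin] with x hx hxU
    rwa [← huv hxU]
  have hlt : ∀ z ∈ U, v z < ⊤ := fun z hz => huv hz ▸ h.lt_top z hz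
  refine ⟨husc, hlt, fun f hf hm => isSubharmonicOn_of_frequently_subMean
    (husc.comp hf.continuousOn hm) (fun z hz => hlt _ (hm hz)) fun p hp => Eventually.frequently ?_⟩
  filter_upwards [eventually_pos_and_closedBall_subset isOpen_ball hp] with r hr
  exact ((h.comp_disk f hf hm).subMean hr.1 hr.2).congr hr.1.le fun z hz => huv (hm (hr.2 hz))

/-- Plurisubharmonicity is a local property. -/
theorem isPSHOn_of_local {u : M → EReal} {U : Set M}
    (h : ∀ p ∈ U, ∃ V, IsOpen V ∧ p ∈ V ∧ IsPSHOn n u V) : IsPSHOn n u U := by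
  have husc : UpperSemicontinuousOn u U := fun p hp => by
    obtain ⟨V, hV, hpV, hu⟩ := h p hp
    intro y hy
    have := hu.usc p hpV y hy
    rw [hV.nhdsWithin_eq hpV] at this
    exact mem_nhdsWithin_of_mem_nhds this
  have hlt : ∀ z ∈ U, u z < ⊤ := fun p hp => by
    obtain ⟨V, -, hpV, hu⟩ := h p hp
    exact hu.lt_top p hpV
  refine ⟨husc, hlt, fun f hf hm => isSubharmonicOn_of_frequently_subMean
    (husc.comp hf.continuousOn hm) (fun z hz => hlt _ (hm hz)) fun p hp => Eventually.frequently ?_⟩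
  obtain ⟨V, hV, hpV, hu⟩ := h (f p) (hm hp)
  have hfV : IsOpen (ball (0 : ℂ) 1 ∩ f ⁻¹' V) :=
    hf.continuousOn.isOpen_inter_preimage isOpen_ball hV
  obtain ⟨ρ, hρ, hball⟩ := Metric.isOpen_iff.1 hfV p ⟨hp, hpV⟩
  -- Test disks are parametrized by the unit disk, so the small disk that `f` maps into `V` is
  -- rescaled to it.
  have haff : MapsTo (fun ζ : ℂ => p + ρ * ζ) (ball 0 1) (ball p ρ) := fun ζ hζ => by
    rw [mem_ball_zero_iff] at hζ
    rw [mem_ball_iff_norm, add_sub_cancel_left, norm_mul, Complex.norm_real,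
      Real.norm_of_nonneg hρ.le]
    nlinarith
  have hd : MDifferentiableOn 𝓘(ℂ, ℂ) 𝓘(ℂ, ℂ) (fun ζ : ℂ => p + ρ * ζ) (ball 0 1) := by
    have : Differentiable ℂ (fun ζ : ℂ => p + ρ * ζ) := by fun_prop
    exact this.mdifferentiable.mdifferentiableOn
  have hsub := hu.comp_disk (fun ζ => f (p + ρ * ζ))
    (hf.comp hd fun ζ hζ => (hball (haff hζ)).1) fun ζ hζ => (hball (haff hζ)).2
  filter_upwards [Ioo_mem_nhdsGT hρ] with r hr
  have h1 := (hsub.subMean (c := 0) (div_pos hr.1 hρ)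
    (closedBall_subset_ball ((div_lt_one hρ).2 hr.2)))
  have h2 := SubMean.of_comp_affine (u := u ∘ f) hρ h1
  rwa [mul_div_cancel₀ _ hρ.ne'] at h2

lemma isPSHOn_coe_of_disk {g : M → ℝ} {U : Set M} (hg : ContinuousOn g U)
    (h : ∀ f : ℂ → M,
      MDifferentiableOn 𝓘(ℂ, ℂ) 𝓘(ℂ, EuclideanSpace ℂ (Fin n)) f (ball 0 1) →
      MapsTo f (ball 0 1) U → IsSubharmonicOn (fun ζ => (g (f ζ) : EReal)) (ball 0 1)) :
    IsPSHOn n (fun z => (g z : EReal)) U :=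
  ⟨(continuous_coe_real_ereal.comp_continuousOn hg).upperSemicontinuousOn,
    fun _ _ => EReal.coe_lt_top _, h⟩

lemma IsPSHOn.add_coe {u : M → EReal} {g : M → ℝ} {U : Set M} (hu : IsPSHOn n u U)
    (hg : IsPSHOn n (fun z => (g z : EReal)) U) (hgc : ContinuousOn g U) :
    IsPSHOn n (fun z => u z + (g z : EReal)) U :=
  ⟨hu.usc.add_coe hgc, fun z hz => EReal.add_coe_lt_top (hu.lt_top z hz), fun f hf hm =>
    (hu.comp_disk f hf hm).add_coe isOpen_ball (hg.comp_disk f hf hm)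
      (hgc.comp hf.continuousOn hm)⟩

lemma IsPSHOn.coe_add_coe {f g : M → ℝ} {U : Set M} (hf : IsPSHOn n (fun z => (f z : EReal)) U)
    (hg : IsPSHOn n (fun z => (g z : EReal)) U) (hgc : ContinuousOn g U) :
    IsPSHOn n (fun z => ((f z + g z : ℝ) : EReal)) U :=
  hf.add_coe hg hgc

lemma IsPSHOn.max {u v : M → EReal} {U : Set M} (hu : IsPSHOn n u U) (hv : IsPSHOn n v U) :
    IsPSHOn n (fun z => max (u z) (v z)) U :=
  ⟨hu.usc.sup hv.usc, fun z hz => max_lt (hu.lt_top z hz) (hv.lt_top z hz), fun f hf hm =>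
    (hu.comp_disk f hf hm).max isOpen_ball (hv.comp_disk f hf hm)⟩

lemma IsPSHOn.const_mul {g : M → ℝ} {U : Set M} {a : ℝ} (ha : 0 < a)
    (hg : IsPSHOn n (fun z => (g z : EReal)) U) (hgc : ContinuousOn g U) :
    IsPSHOn n (fun z => ((a * g z : ℝ) : EReal)) U :=
  isPSHOn_coe_of_disk (continuousOn_const.mul hgc) fun f hf hm =>
    (hg.comp_disk f hf hm).const_mul isOpen_ball ha (hgc.comp hf.continuousOn hm)

lemma isPSHOn_of_uniform_approx {g : M → ℝ} {U : Set M} (hgc : ContinuousOn g U)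
    (h : ∀ ε > 0, ∃ f : M → ℝ, IsPSHOn n (fun z => (f z : EReal)) U ∧
      ∀ z ∈ U, |g z - f z| ≤ ε) : IsPSHOn n (fun z => (g z : EReal)) U :=
  isPSHOn_coe_of_disk hgc fun f hf hm =>
    isSubharmonicOn_of_uniform_approx isOpen_ball (hgc.comp hf.continuousOn hm) fun ε hε => by
      obtain ⟨k, hk, hgk⟩ := h ε hε
      exact ⟨k ∘ f, hk.comp_disk f hf hm, fun z hz => hgk _ (hm hz)⟩

lemma isPSHOn_const (a : ℝ) (U : Set M) : IsPSHOn n (fun _ => (a : EReal)) U :=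
  isPSHOn_coe_of_disk continuousOn_const fun _ _ _ =>
    isSubharmonicOn_of_frequently_subMean upperSemicontinuousOn_const
      (fun _ _ => EReal.coe_lt_top _) fun _ _ => Eventually.frequently <|
        eventually_subMean_of_re_le (h := fun _ => (a : ℂ))
          (Eventually.of_forall fun _ => differentiableAt_const _)
          (Eventually.of_forall fun _ => le_rfl) rfl

/-- Uniformly convergent series of continuous plurisubharmonic functions. -/
lemma isPSHOn_tsum {F : ℕ → M → ℝ} {U : Set M} {b : ℕ → ℝ} (hb : Summable b)
    (hF : ∀ i, ContinuousOn (F i) U) (hFb : ∀ i, ∀ z ∈ U, |F i z| ≤ b i)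
    (hpsh : ∀ i, IsPSHOn n (fun z => (F i z : EReal)) U) :
    IsPSHOn n (fun z => ((∑' i, F i z : ℝ) : EReal)) U := by
  have hunif := tendstoUniformlyOn_tsum_nat hb (f := F) (s := U) fun i z hz => hFb i z hz
  refine isPSHOn_of_uniform_approx (continuousOn_tsum hF hb fun i z hz => hFb i z hz)
    fun ε hε => ?_
  obtain ⟨N, hN⟩ := (Metric.tendstoUniformlyOn_iff.1 hunif ε hε).exists
  refine ⟨fun z => ∑ i ∈ Finset.range N, F i z, ?_, fun z hz => (hN z hz).le⟩
  clear hN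
  induction N with
  | zero => simpa using isPSHOn_const (n := n) 0 U
  | succ N ih =>
    simp only [Finset.sum_range_succ]
    exact ih.coe_add_coe (hpsh N) (hF N)

/-- The composition of a chart with a function that is supported from below by real parts of
holomorphic functions is plurisubharmonic. -/
theorem isPSHOn_comp_chart {φ : OpenPartialHomeomorph M (EuclideanSpace ℂ (Fin n))}
    (hφ : φ ∈ holoCharts n M) {g : EuclideanSpace ℂ (Fin n) → EReal} (hg : UpperSemicontinuous g)
    (hlt : ∀ x, g x < ⊤)
    (h : ∀ p, g p ≠ ⊥ → ∃ h : EuclideanSpace ℂ (Fin n) → ℂ,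
      (∀ᶠ z in 𝓝 p, DifferentiableAt ℂ h z) ∧ (∀ᶠ z in 𝓝 p, ((h z).re : EReal) ≤ g z) ∧
      g p = ((h p).re : EReal)) {U : Set M} (hU : U ⊆ φ.source) :
    IsPSHOn n (fun z => g (φ z)) U := by
  have husc : UpperSemicontinuousOn (fun z => g (φ z)) U :=
    (hg.upperSemicontinuousOn univ).comp (φ.continuousOn.mono hU) (mapsTo_univ _ _)
  refine ⟨husc, fun z _ => hlt _, fun f hf hm => isSubharmonicOn_of_frequently_subMean
    (husc.comp hf.continuousOn hm) (fun z _ => hlt _) fun p hp => Eventually.frequently ?_⟩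
  have hφd : MDifferentiableOn 𝓘(ℂ, EuclideanSpace ℂ (Fin n)) 𝓘(ℂ, EuclideanSpace ℂ (Fin n))
      φ φ.source := (contMDiffOn_of_mem_maximalAtlas hφ).mdifferentiableOn (by simp)
  have hd : DifferentiableOn ℂ (φ ∘ f) (ball 0 1) :=
    (hφd.comp hf fun z hz => hU (hm hz)).differentiableOn
  have hdp : ∀ z ∈ ball (0 : ℂ) 1, DifferentiableAt ℂ (φ ∘ f) z := fun z hz =>
    hd.differentiableAt (isOpen_ball.mem_nhds hz)
  by_cases hbot : g (φ (f p)) = ⊥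
  · exact Eventually.of_forall fun r => subMean_of_eq_bot hbot r
  · obtain ⟨k, hkd, hkle, hk⟩ := h _ hbot
    have ht := (hdp p hp).continuousAt.tendsto
    refine eventually_subMean_of_re_le (h := k ∘ (φ ∘ f)) ?_ (ht.eventually hkle) hk
    filter_upwards [ht.eventually hkd, isOpen_ball.mem_nhds hp] with z hz hzb
    exact DifferentiableAt.comp z hz (hdp z hzb)

lemma isPSHOn_re_chart {φ : OpenPartialHomeomorph M (EuclideanSpace ℂ (Fin n))}
    (hφ : φ ∈ holoCharts n M) {h : EuclideanSpace ℂ (Fin n) → ℂ} (hh : Differentiable ℂ h)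
    {U : Set M} (hU : U ⊆ φ.source) :
    IsPSHOn n (fun z => ((h (φ z)).re : EReal)) U :=
  isPSHOn_comp_chart (g := fun x => ((h x).re : EReal)) hφ
    (continuous_coe_real_ereal.comp (Complex.continuous_re.comp hh.continuous)).upperSemicontinuous
    (fun _ => EReal.coe_lt_top _) (fun _ _ => ⟨h, Eventually.of_forall fun z => hh z,
      Eventually.of_forall fun _ => le_rfl, rfl⟩) hU

/-- At each `p` the squared norm exceeds the real part of a complex affine function by exactly `‖z -
p‖ ^ 2`. -/
lemma isPSHOn_normSq_chart {φ : OpenPartialHomeomorph M (EuclideanSpace ℂ (Fin n))}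
    (hφ : φ ∈ holoCharts n M) (a : EuclideanSpace ℂ (Fin n)) {U : Set M} (hU : U ⊆ φ.source) :
    IsPSHOn n (fun z => ((‖φ z - a‖ ^ 2 : ℝ) : EReal)) U := by
  refine isPSHOn_comp_chart (g := fun x => ((‖x - a‖ ^ 2 : ℝ) : EReal)) hφ
    (continuous_coe_real_ereal.comp (by fun_prop)).upperSemicontinuous
    (fun _ => EReal.coe_lt_top _) (fun p _ => ?_) hU
  have hre : ∀ z, ((‖p - a‖ ^ 2 : ℝ) + 2 * innerSL ℂ (p - a) (z - p) : ℂ).re =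
      ‖z - a‖ ^ 2 - ‖z - p‖ ^ 2 := fun z => by
    have := norm_add_sq (𝕜 := ℂ) (p - a) (z - p)
    rw [sub_add_sub_cancel' (p) a z] at this
    rw [this]
    simp [inner_sub_left, -Complex.ofReal_pow]
  refine ⟨fun z => ((‖p - a‖ ^ 2 : ℝ) + 2 * innerSL ℂ (p - a) (z - p) : ℂ),
    Eventually.of_forall fun z => by fun_prop, Eventually.of_forall fun z => ?_, ?_⟩
  · rw [hre, EReal.coe_le_coe_iff]
    have := sq_nonneg ‖z - p‖
    linarith
  · rw [hre]; simp

lemma chart_restr_mem_holoCharts {φ : OpenPartialHomeomorph M (EuclideanSpace ℂ (Fin n))}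
    (hφ : φ ∈ holoCharts n M) {s : Set M} (hs : IsOpen s) : φ.restr s ∈ holoCharts n M :=
  restr_mem_maximalAtlas (contDiffGroupoid ω 𝓘(ℂ, EuclideanSpace ℂ (Fin n))) hφ hs

end Psh

/-! ### Statement (2): from logarithmic poles to a strictly psh function. -/

section StrictlyPsh

open Metric Set Filter Topology

variable {n : ℕ} {M : Type*} [TopologicalSpace M]

lemma logDist_of_ne {φ : OpenPartialHomeomorph M (EuclideanSpace ℂ (Fin n))} {z w : M}
    (h : φ z ≠ φ w) : logDist n φ z w = ((Real.log ‖φ z - φ w‖ : ℝ) : EReal) := by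
  rw [logDist, ← ofReal_norm, ENNReal.log_ofReal_of_pos (norm_pos_iff.2 (sub_ne_zero.2 h))]

lemma logDist_of_eq {φ : OpenPartialHomeomorph M (EuclideanSpace ℂ (Fin n))} {z w : M}
    (h : φ z = φ w) : logDist n φ z w = ⊥ := by
  rw [logDist, h, sub_self, enorm_zero, ENNReal.log_zero]

lemma logDist_le {φ : OpenPartialHomeomorph M (EuclideanSpace ℂ (Fin n))} {z w : M} {t : ℝ}
    (ht : 0 < t) (h : ‖φ z - φ w‖ ≤ t) : logDist n φ z w ≤ ((Real.log t : ℝ) : EReal) := by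
  rw [logDist, ← ofReal_norm, ← ENNReal.log_ofReal_of_pos ht]
  exact ENNReal.log_le_log (ENNReal.ofReal_le_ofReal h)

lemma isOpen_chart_ball (φ : OpenPartialHomeomorph M (EuclideanSpace ℂ (Fin n)))
    (a : EuclideanSpace ℂ (Fin n)) (r : ℝ) : IsOpen (φ.source ∩ φ ⁻¹' ball a r) :=
  φ.isOpen_inter_preimage isOpen_ball

/-- It is the image of a compact ball under the inverse chart. Its complement is the outer open set
in both gluings. -/
lemma isClosed_chart_closedBall [T2Space M]
    (φ : OpenPartialHomeomorph M (EuclideanSpace ℂ (Fin n)))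
    {a : EuclideanSpace ℂ (Fin n)} {r : ℝ} (h : closedBall a r ⊆ φ.target) :
    IsClosed (φ.source ∩ φ ⁻¹' closedBall a r) := by
  have : φ.source ∩ φ ⁻¹' closedBall a r = φ.symm '' closedBall a r := by
    rw [φ.symm.image_eq_target_inter_inv_preimage (by simpa using h)]
    simp
  rw [this]
  exact ((isCompact_closedBall a r).image_of_continuousOn (φ.continuousOn_symm.mono h)).isClosed

lemma exists_closedBall_subset_target {φ : OpenPartialHomeomorph M (EuclideanSpace ℂ (Fin n))}
    {w : M} (hw : w ∈ φ.source) : ∃ r > 0, closedBall (φ w) r ⊆ φ.target :=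
  Metric.nhds_basis_closedBall.mem_iff.1 (φ.open_target.mem_nhds (φ.map_source hw))

variable [ChartedSpace (EuclideanSpace ℂ (Fin n)) M]

/-- A negative continuous plurisubharmonic function with a strict logarithmic pole at `w` yields a
bounded continuous plurisubharmonic function that is strictly plurisubharmonic near `w`. -/
theorem exists_psh_strict_near [T2Space M] {w : M} {v : M → EReal} (hvc : Continuous v)
    (hv : IsPSH n v) (hneg : ∀ z, v z < 0) (hpole : HasStrictLogPole n v w) :
    ∃ F : M → ℝ, Continuous F ∧ (∀ z, |F z| ≤ 1) ∧ IsPSH n (fun z => (F z : EReal)) ∧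
      ∃ φ ∈ holoCharts n M, w ∈ φ.source ∧ ∃ ε : ℝ, 0 < ε ∧
        IsPSHOn n (fun z => ((F z - ε * ‖φ z‖ ^ 2 : ℝ) : EReal)) φ.source := by
  obtain ⟨φ, hφ, hw, c₁, c₂, hbd⟩ := hpole
  obtain ⟨r, hr, hball⟩ := exists_closedBall_subset_target hw
  set D₁ : Set M := φ.source ∩ φ ⁻¹' ball (φ w) r with hD₁
  set D₂ : Set M := (φ.source ∩ φ ⁻¹' closedBall (φ w) (r / 2))ᶜ with hD₂
  have oD₁ : IsOpen D₁ := isOpen_chart_ball φ _ _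
  have oD₂ : IsOpen D₂ := (isClosed_chart_closedBall φ
    ((closedBall_subset_closedBall (by linarith)).trans hball)).isOpen_compl
  have hcover : ∀ z, z ∈ D₁ ∨ z ∈ D₂ := fun z => by
    by_contra hcon
    push Not at hcon
    obtain ⟨h1, h2⟩ := hcon
    have h2 := not_not.1 h2
    exact h1 ⟨h2.1, closedBall_subset_ball (by linarith) h2.2⟩
  -- Large enough that `‖z - w‖ ^ 2 - K` lies below the pole's lower bound on the shell between
  -- radii `r / 2` and `r`.
  set K : ℝ := |r ^ 2 - Real.log (r / 2) - c₁| + 1 with hK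
  have hK1 : r ^ 2 - K ≤ Real.log (r / 2) + c₁ := by
    have := le_abs_self (r ^ 2 - Real.log (r / 2) - c₁)
    linarith
  have hK0 : 0 < K := by positivity
  classical
  let κ : M → ℝ := fun z => if z ∈ D₁ then ‖φ z - φ w‖ ^ 2 + -K else -K
  have hκ₁ : ∀ z ∈ D₁, κ z = ‖φ z - φ w‖ ^ 2 + -K := fun z hz => if_pos hz
  have hκlow : ∀ z, -K ≤ κ z := fun z => by
    by_cases hz : z ∈ D₁
    · rw [hκ₁ z hz]; have := sq_nonneg ‖φ z - φ w‖; linarith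
    · exact (if_neg hz).ge
  have hκup : ∀ z, κ z ≤ r ^ 2 - K := fun z => by
    by_cases hz : z ∈ D₁
    · rw [hκ₁ z hz]
      have h1 : ‖φ z - φ w‖ < r := mem_ball_iff_norm.1 hz.2
      have h2 := norm_nonneg (φ z - φ w)
      nlinarith
    · have : κ z = -K := if_neg hz
      rw [this]; have := sq_nonneg r; linarith
  have hmax₂ : ∀ z ∈ D₂, max (v z) (κ z : EReal) = max (v z) ((-K : ℝ) : EReal) := by
    intro z hz
    by_cases h1 : z ∈ D₁
    · have h2 : r / 2 < ‖φ z - φ w‖ := by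
        by_contra hcon
        exact hz ⟨h1.1, mem_closedBall_iff_norm.2 (not_lt.1 hcon)⟩
      have h3 : φ z ≠ φ w := fun h => by
        rw [h, sub_self, norm_zero] at h2
        linarith
      have h4 : (κ z : EReal) ≤ v z := by
        refine le_trans ?_ (hbd z h1.1).1
        rw [logDist_of_ne h3, ← EReal.coe_add, EReal.coe_le_coe_iff]
        have := Real.log_le_log (by positivity) h2.le
        linarith [hκup z]
      rw [max_eq_left h4, max_eq_left ((EReal.coe_le_coe_iff.2 (hκlow z)).trans h4)]
    · have : κ z = -K := if_neg h1
      rw [this]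
  let F : M → ℝ := fun z => (max (v z) (κ z : EReal)).toReal
  have hF : ∀ z, (F z : EReal) = max (v z) (κ z : EReal) := fun z =>
    EReal.coe_toReal (max_lt ((hneg z).trans (EReal.coe_lt_top 0)) (EReal.coe_lt_top _)).ne
      ((EReal.bot_lt_coe _).trans_le (le_max_right _ _)).ne'
  have hnc : ContinuousOn (fun z => ‖φ z - φ w‖ ^ 2 + -K) D₁ := by
    have := φ.continuousOn.mono (inter_subset_left : D₁ ⊆ φ.source)
    fun_prop
  have hFc : Continuous F := by
    rw [EReal.isEmbedding_coe.continuous_iff, continuous_iff_continuousAt]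
    intro z
    rcases hcover z with hz | hz
    · have h1 : ContinuousOn (fun z => max (v z) ((‖φ z - φ w‖ ^ 2 + -K : ℝ) : EReal)) D₁ :=
        continuous_max.comp_continuousOn (hvc.continuousOn.prodMk
          (continuous_coe_real_ereal.comp_continuousOn hnc))
      refine (h1.congr fun x hx => ?_).continuousAt (oD₁.mem_nhds hz)
      rw [← hκ₁ x hx, ← hF x]; rfl
    · have h1 : ContinuousOn (fun z => max (v z) ((-K : ℝ) : EReal)) D₂ :=
        (hvc.max continuous_const).continuousOn
      refine (h1.congr fun x hx => ?_).continuousAt (oD₂.mem_nhds hz)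
      rw [← hmax₂ x hx, ← hF x]; rfl
  have hFlow : ∀ z, -K ≤ F z := fun z => by
    rw [← EReal.coe_le_coe_iff, hF]
    exact (EReal.coe_le_coe_iff.2 (hκlow z)).trans (le_max_right _ _)
  have hFup : ∀ z, F z ≤ r ^ 2 := fun z => by
    rw [← EReal.coe_le_coe_iff, hF]
    refine max_le ((hneg z).le.trans (EReal.coe_le_coe_iff.2 (sq_nonneg r)))
      (EReal.coe_le_coe_iff.2 ?_)
    linarith [hκup z]
  have hFpsh : IsPSH n (fun z => (F z : EReal)) := by
    refine isPSHOn_of_local fun z _ => ?_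
    rcases hcover z with hz | hz
    · refine ⟨D₁, oD₁, hz, ((hv.mono (subset_univ _)).max
        ((isPSHOn_normSq_chart hφ (φ w) inter_subset_left).coe_add_coe
          (isPSHOn_const (-K) D₁) continuousOn_const)).congr fun x hx => ?_⟩
      simp only
      rw [hF x, hκ₁ x hx]
    · refine ⟨D₂, oD₂, hz, ((hv.mono (subset_univ _)).max
        (isPSHOn_const (-K) D₂)).congr fun x hx => ?_⟩
      simp only
      rw [hF x, hmax₂ x hx]
  set B : ℝ := K + r ^ 2 with hB
  have hB0 : 0 < B := by positivity
  refine ⟨fun z => B⁻¹ * F z, by fun_prop, fun z => ?_,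
    hFpsh.const_mul (inv_pos.2 hB0) hFc.continuousOn, ?_⟩
  · rw [abs_mul, abs_of_pos (inv_pos.2 hB0), inv_mul_eq_div, div_le_one hB0, abs_le]
    have := sq_nonneg r
    constructor
    · linarith [hFlow z]
    · linarith [hFup z]
  -- Here the quadratic branch wins the maximum. The set contains `w` because `v w = -∞`.
  · set V : Set M := D₁ ∩ {z | v z < ((-K : ℝ) : EReal)} with hV
    have oV : IsOpen V := oD₁.inter (isOpen_lt hvc continuous_const)
    have hsrc : (φ.restr V).source ⊆ V := by
      rw [φ.restr_source, oV.interior_eq]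
      exact inter_subset_right
    refine ⟨φ.restr V, chart_restr_mem_holoCharts hφ oV, ?_, B⁻¹, inv_pos.2 hB0, ?_⟩
    · rw [φ.restr_source, oV.interior_eq]
      refine ⟨hw, ⟨hw, mem_ball_self hr⟩, ?_⟩
      have := (hbd w hw).2
      rw [logDist_of_eq rfl, EReal.bot_add] at this
      exact this.trans_lt (EReal.bot_lt_coe _)
    -- Recentering: `‖x - φ w‖ ^ 2 - ‖x‖ ^ 2` is the real part of a complex affine function, so the
    -- difference is even pluriharmonic.
    · refine (isPSHOn_re_chart hφ (h := fun x => ((B⁻¹ : ℝ) : ℂ) *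
        (-2 * innerSL ℂ (φ w) x + ((‖φ w‖ ^ 2 - K : ℝ) : ℂ))) (by fun_prop)
        (hsrc.trans (inter_subset_left.trans inter_subset_left))).congr fun x hx => ?_
      have hxV := hsrc hx
      have hFx : F x = ‖φ x - φ w‖ ^ 2 + -K := by
        rw [← EReal.coe_eq_coe_iff, hF x, ← hκ₁ x hxV.1]
        exact max_eq_right (le_of_lt (lt_of_lt_of_le hxV.2 (EReal.coe_le_coe_iff.2 (hκlow x))))
      simp only
      rw [EReal.coe_eq_coe_iff, hFx, norm_sub_rev, norm_sub_sq (𝕜 := ℂ)]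
      rw [Complex.re_ofReal_mul]
      simp [-Complex.ofReal_sub, -Complex.ofReal_pow]
      ring

lemma exists_boundedContinuousStrictlyPSH [T2Space M] [SecondCountableTopology M] [Nonempty M]
    (h : ∀ w : M, ∃ v : M → EReal, Continuous v ∧ IsPSH n v ∧ (∀ z, v z < 0) ∧
      HasStrictLogPole n v w) : HasBoundedContinuousStrictlyPSH n M := by
  have h' : ∀ w : M, ∃ F : M → ℝ, Continuous F ∧ (∀ z, |F z| ≤ 1) ∧
      IsPSH n (fun z => (F z : EReal)) ∧
      ∃ φ ∈ holoCharts n M, w ∈ φ.source ∧ ∃ ε : ℝ, 0 < ε ∧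
        IsPSHOn n (fun z => ((F z - ε * ‖φ z‖ ^ 2 : ℝ) : EReal)) φ.source := fun w => by
    obtain ⟨v, h1, h2, h3, h4⟩ := h w
    exact exists_psh_strict_near h1 h2 h3 h4
  choose F hFc hFb hFpsh φ hφ hw ε hε hstrict using h'
  obtain ⟨s, hs, hcov⟩ := TopologicalSpace.countable_cover_nhds
    fun w => (φ w).open_source.mem_nhds (hw w)
  have hne : s.Nonempty := by
    by_contra hcon
    rw [not_nonempty_iff_eq_empty.1 hcon] at hcov
    simp only [mem_empty_iff_false, iUnion_of_empty, iUnion_empty] at hcov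
    exact empty_ne_univ hcov
  obtain ⟨x, rfl⟩ := hs.exists_eq_range hne
  let G : ℕ → M → ℝ := fun i z => (1 / 2 : ℝ) ^ i * F (x i) z
  have hGc : ∀ i, Continuous (G i) := fun i => continuous_const.mul (hFc _)
  have hGb : ∀ i z, |G i z| ≤ (1 / 2 : ℝ) ^ i := fun i z => by
    rw [abs_mul, abs_of_pos (by positivity)]
    exact mul_le_of_le_one_right (by positivity) (hFb _ _)
  have hsum : Summable fun i : ℕ => (1 / 2 : ℝ) ^ i := summable_geometric_two
  refine ⟨fun z => ∑' i, G i z, continuous_tsum hGc hsum hGb, ⟨2, fun z => ?_⟩, fun p => ?_⟩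
  · rw [← Real.norm_eq_abs]
    exact tsum_of_norm_bounded hasSum_geometric_two fun i => hGb i z
  · have : p ∈ ⋃ w ∈ range x, (φ w).source := hcov ▸ mem_univ p
    simp only [mem_range, iUnion_exists, iUnion_iUnion_eq', mem_iUnion] at this
    obtain ⟨i, hi⟩ := this
    refine ⟨φ (x i), hφ _, hi, (1 / 2 : ℝ) ^ i * ε (x i), mul_pos (by positivity) (hε _), ?_⟩
    have hgc : ContinuousOn (fun z => F (x i) z - ε (x i) * ‖φ (x i) z‖ ^ 2) (φ (x i)).source := by
      have h1 := (φ (x i)).continuousOn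
      have h2 := (hFc (x i)).continuousOn (s := (φ (x i)).source)
      fun_prop
    have h1 := (hstrict (x i)).const_mul (a := (1 / 2 : ℝ) ^ i) (by positivity) hgc
    -- The `i`-th term absorbs the subtracted `ε ‖z‖ ^ 2`; the remaining series only has to be psh.
    have hrest : ∀ j, Continuous fun z => if j = i then 0 else G j z := fun j => by
      split_ifs
      exacts [continuous_const, hGc j]
    have hrestb : ∀ j z, |if j = i then 0 else G j z| ≤ (1 / 2 : ℝ) ^ j := fun j z => by
      split_ifs
      · rw [abs_zero]; positivity
      · exact hGb j z
    have h2 : IsPSHOn n (fun z => ((∑' j, (if j = i then 0 else G j z) : ℝ) : EReal))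
        (φ (x i)).source := by
      refine isPSHOn_tsum (F := fun j z => if j = i then 0 else G j z) hsum
        (fun j => (hrest j).continuousOn) (fun j z _ => hrestb j z) fun j => ?_
      by_cases hj : j = i
      · simpa [hj] using isPSHOn_const (n := n) 0 (φ (x i)).source
      · simpa only [hj, if_false] using ((hFpsh (x j)).mono (subset_univ _)).const_mul
          (a := (1 / 2 : ℝ) ^ j) (by positivity) (hFc _).continuousOn
    refine (h1.coe_add_coe h2 (continuous_tsum hrest hsum hrestb).continuousOn).congr
      fun z _ => ?_
    simp only
    rw [(hsum.of_norm_bounded fun j => hGb j z : Summable fun j => G j z).tsum_eq_add_tsum_ite i,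
      ← EReal.coe_sub]
    congr 1
    simp only [G]
    ring

end StrictlyPsh

/-! ### Statement (1): two-sided bounds for the Green function. -/

section Green

open Metric Set Filter Topology

variable {n : ℕ} {M : Type*} [TopologicalSpace M] [ChartedSpace (EuclideanSpace ℂ (Fin n)) M]

/-- The function equal to `log x + 1 / 2` for `x ≤ 1` and to `x ^ 2 / 2` for `x ≥ 1`, which is a
convex increasing function of `log x`. -/
noncomputable def logSq (x : ℝ) : EReal :=
  ENNReal.log (ENNReal.ofReal (min x 1)) + ((1 / 2 + (x ^ 2 - (min x 1) ^ 2) / 2 : ℝ) : EReal)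

lemma continuous_logSq : Continuous logSq := by
  have h1 : Continuous fun x : ℝ => ENNReal.log (ENNReal.ofReal (min x 1)) :=
    ENNReal.continuous_log.comp (ENNReal.continuous_ofReal.comp (by fun_prop))
  have h2 : Continuous fun x : ℝ => ((1 / 2 + (x ^ 2 - (min x 1) ^ 2) / 2 : ℝ) : EReal) :=
    continuous_coe_real_ereal.comp (by fun_prop)
  exact continuous_iff_continuousAt.2 fun x =>
    (EReal.continuousAt_add (Or.inr (EReal.coe_ne_bot _)) (Or.inr (EReal.coe_ne_top _))).comp
      (h1.continuousAt.prodMk h2.continuousAt)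

lemma logSq_le (x : ℝ) : logSq x ≤ ((1 / 2 + x ^ 2 / 2 : ℝ) : EReal) := by
  have h1 : ENNReal.log (ENNReal.ofReal (min x 1)) ≤ 0 := by
    simp
  have h2 : logSq x ≤ 0 + ((1 / 2 + x ^ 2 / 2 : ℝ) : EReal) := by
    refine add_le_add h1 (EReal.coe_le_coe_iff.2 ?_)
    have := sq_nonneg (min x 1)
    linarith
  rwa [zero_add] at h2

lemma logSq_of_nonpos {x : ℝ} (hx : x ≤ 0) : logSq x = ⊥ := by
  rw [logSq, ENNReal.ofReal_of_nonpos ((min_le_left _ _).trans hx), ENNReal.log_zero,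
    EReal.bot_add]

lemma logSq_of_le_one {x : ℝ} (hx : 0 < x) (hx1 : x ≤ 1) :
    logSq x = ((Real.log x + 1 / 2 : ℝ) : EReal) := by
  rw [logSq, min_eq_left hx1, ENNReal.log_ofReal_of_pos hx, ← EReal.coe_add]
  simp

lemma logSq_of_one_le {x : ℝ} (hx1 : 1 ≤ x) : logSq x = ((x ^ 2 / 2 : ℝ) : EReal) := by
  rw [logSq, min_eq_right hx1, ENNReal.ofReal_one, ENNReal.log_one, zero_add]
  congr 1
  ring

lemma log_le_sq {x : ℝ} (hx : 0 < x) : Real.log x ≤ (x ^ 2 - 1) / 2 := by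
  have h := Real.log_le_sub_one_of_pos (pow_pos hx 2)
  rw [Real.log_pow] at h
  push_cast at h
  linarith

/-- `logSq` lies above its tangents, as a function of `log x`. -/
lemma exists_tangent_le_logSq {y : ℝ} (hy : 0 < y) :
    ∃ α b : ℝ, 0 ≤ α ∧ logSq y = (b : EReal) ∧
      ∀ x, 0 < x → ((α * Real.log (x / y) + b : ℝ) : EReal) ≤ logSq x := by
  rcases le_total y 1 with hy1 | hy1
  · refine ⟨1, _, zero_le_one, logSq_of_le_one hy hy1, fun x hx => ?_⟩
    rw [Real.log_div hx.ne' hy.ne']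
    rcases le_total x 1 with hx1 | hx1
    · rw [logSq_of_le_one hx hx1, EReal.coe_le_coe_iff]
      linarith
    · rw [logSq_of_one_le hx1, EReal.coe_le_coe_iff]
      linarith [log_le_sq hx]
  · have hsq : ∀ x, 0 < x → y ^ 2 * Real.log (x / y) + y ^ 2 / 2 ≤ x ^ 2 / 2 := fun x hx => by
      have h := mul_le_mul_of_nonneg_left (log_le_sq (div_pos hx hy)) (sq_nonneg y)
      have h2 : y ^ 2 * (((x / y) ^ 2 - 1) / 2) = x ^ 2 / 2 - y ^ 2 / 2 := by
        field_simp
      linarith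
    refine ⟨y ^ 2, _, sq_nonneg y, logSq_of_one_le hy1, fun x hx => ?_⟩
    rcases le_total x 1 with hx1 | hx1
    · rw [logSq_of_le_one hx hx1, EReal.coe_le_coe_iff]
      -- The tangent at `y ≥ 1` lies below the graph at `x = 1`. To the left it has slope `y ^ 2 ≥
      -- 1` in `log x`, against slope `1` for `logSq`, so it stays below.
      have h1 := hsq 1 one_pos
      rw [Real.log_div one_ne_zero hy.ne', Real.log_one] at h1
      rw [Real.log_div hx.ne' hy.ne']
      have h2 := Real.log_nonpos hx.le hx1
      have h3 : 1 ≤ y ^ 2 := one_le_pow₀ hy1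
      nlinarith
    · rw [logSq_of_one_le hx1, EReal.coe_le_coe_iff]
      exact hsq x hx

/-- A tangent in `log x` composed with the logarithm of a complex affine function supports it from
below at each `p ≠ a`; at `p = a` the value is `-∞`. -/
lemma isPSHOn_logSq_chart {φ : OpenPartialHomeomorph M (EuclideanSpace ℂ (Fin n))}
    (hφ : φ ∈ holoCharts n M) (a : EuclideanSpace ℂ (Fin n)) {ρ : ℝ} (hρ : 0 < ρ) {U : Set M}
    (hU : U ⊆ φ.source) : IsPSHOn n (fun z => logSq (‖φ z - a‖ / ρ)) U := by
  refine isPSHOn_comp_chart (g := fun x => logSq (‖x - a‖ / ρ)) hφ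
    (continuous_logSq.comp (by fun_prop)).upperSemicontinuous
    (fun x => (logSq_le _).trans_lt (EReal.coe_lt_top _)) (fun p hp => ?_) hU
  have hpa : 0 < ‖p - a‖ := by
    refine (norm_nonneg _).lt_of_ne fun h => hp ?_
    rw [← h, zero_div]
    exact logSq_of_nonpos le_rfl
  obtain ⟨α, b, hα, hb, htan⟩ := exists_tangent_le_logSq (div_pos hpa hρ)
  -- By Cauchy–Schwarz `|q z| ≤ ‖z - a‖ / ‖p - a‖`, with equality at `p`, where `q = 1`.
  let q : EuclideanSpace ℂ (Fin n) → ℂ := fun z => innerSL ℂ (p - a) (z - a) / (‖p - a‖ : ℂ) ^ 2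
  have hqd : Differentiable ℂ q := by fun_prop
  have hqp : q p = 1 := by
    have h0 : (‖p - a‖ : ℂ) ^ 2 ≠ 0 := by
      have : (‖p - a‖ : ℂ) ≠ 0 := by exact_mod_cast hpa.ne'
      positivity
    simp only [q]
    rw [innerSL_apply_apply, inner_self_eq_norm_sq_to_K]
    exact div_self h0
  have hslit : ∀ᶠ z in 𝓝 p, q z ∈ Complex.slitPlane :=
    hqd.continuous.continuousAt.eventually_mem
      (Complex.isOpen_slitPlane.mem_nhds (hqp ▸ Complex.one_mem_slitPlane))
  refine ⟨fun z => (α : ℂ) * Complex.log (q z) + (b : ℂ), ?_, ?_, ?_⟩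
  · filter_upwards [hslit] with z hz
    exact ((differentiableAt_const _).mul ((hqd z).clog hz)).add (differentiableAt_const _)
  · filter_upwards [hslit] with z hz
    have hq0 : 0 < ‖q z‖ := norm_pos_iff.2 (Complex.slitPlane_ne_zero hz)
    have hqle : ‖q z‖ ≤ ‖z - a‖ / ‖p - a‖ := by
      simp only [q]
      rw [norm_div, norm_pow, Complex.norm_real, norm_norm, div_le_div_iff₀ (by positivity) hpa,
        innerSL_apply_apply]
      have := mul_le_mul_of_nonneg_right (norm_inner_le_norm (𝕜 := ℂ) (p - a) (z - a)) hpa.le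
      linarith
    have hza : 0 < ‖z - a‖ := by
      have := hq0.trans_le hqle
      rwa [div_pos_iff_of_pos_right hpa] at this
    refine le_trans (EReal.coe_le_coe_iff.2 ?_) (htan _ (div_pos hza hρ))
    rw [Complex.add_re, Complex.re_ofReal_mul, Complex.log_re, Complex.ofReal_re,
      div_div_div_cancel_right₀ hρ.ne']
    have := mul_le_mul_of_nonneg_left (Real.log_le_log hq0 hqle) hα
    linarith
  · simp only
    rw [hb, hqp]
    simp

/-- In a coordinate ball of radius `R` around `w`, negative plurisubharmonic functions with a
logarithmic pole at `w` are bounded above by `log (‖z - w‖ / R)`. -/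
theorem le_logDist_of_hasLogPole {φ : OpenPartialHomeomorph M (EuclideanSpace ℂ (Fin n))}
    (hφ : φ ∈ holoCharts n M) {w : M} (hw : w ∈ φ.source) {R : ℝ} (hR : 0 < R)
    (hball : ball (φ w) R ⊆ φ.target) {u : M → EReal} (hu : IsPSH n u) (hneg : ∀ x, u x < 0)
    (hpole : HasLogPole n u w) {z : M} (hz : z ∈ φ.source) (hzR : φ z ∈ ball (φ w) R) :
    u z ≤ logDist n φ z w + ((-Real.log R : ℝ) : EReal) := by
  obtain ⟨ψ, hψ, hwψ, c, hc⟩ := hpole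
  by_cases hzw : z = w
  · subst hzw
    have := hc z hwψ
    rw [logDist_of_eq rfl, EReal.bot_add] at this
    exact this.trans bot_le
  have hne : φ z ≠ φ w := fun h => hzw (φ.injOn hz hw h)
  have hn : 0 < ‖φ z - φ w‖ := norm_pos_iff.2 (sub_ne_zero.2 hne)
  -- The disk `ζ ↦ φ w + ζ • b` has radius `R` and passes through `φ z` at `ζ = ‖φ z - φ w‖ / R`.
  let b : EuclideanSpace ℂ (Fin n) := ((R / ‖φ z - φ w‖ : ℝ) : ℂ) • (φ z - φ w)
  have hb : ‖b‖ = R := by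
    rw [norm_smul, Complex.norm_real, Real.norm_of_nonneg (by positivity)]
    field_simp
  let e : ℂ → EuclideanSpace ℂ (Fin n) := fun ζ => φ w + ζ • b
  have he : Differentiable ℂ e := by fun_prop
  have heb : MapsTo e (ball 0 1) φ.target := fun ζ hζ => hball <| by
    rw [mem_ball_zero_iff] at hζ
    rw [mem_ball_iff_norm, add_sub_cancel_left, norm_smul, hb]
    exact mul_lt_of_lt_one_left hR hζ
  have hf : MDifferentiableOn 𝓘(ℂ, ℂ) 𝓘(ℂ, EuclideanSpace ℂ (Fin n)) (φ.symm ∘ e) (ball 0 1) :=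
    ((contMDiffOn_symm_of_mem_maximalAtlas hφ).mdifferentiableOn (by simp)).comp
      he.mdifferentiable.mdifferentiableOn heb
  have hf0 : (φ.symm ∘ e) 0 = w := by simp [e, φ.left_inv hw]
  have hsub := hu.comp_disk _ hf (mapsTo_univ _ _)
  have hopen : IsOpen (ball (0 : ℂ) 1 ∩ (φ.symm ∘ e) ⁻¹' ψ.source) :=
    hf.continuousOn.isOpen_inter_preimage isOpen_ball ψ.open_source
  have h0mem : (0 : ℂ) ∈ ball (0 : ℂ) 1 ∩ (φ.symm ∘ e) ⁻¹' ψ.source :=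
    ⟨mem_ball_self one_pos, by rw [mem_preimage, hf0]; exact hwψ⟩
  -- The pole may be stated in another chart `ψ`. Differentiability at the origin gives distance at
  -- most `C |ζ|` in `ψ`, which only changes the additive constant.
  have hd : DifferentiableAt ℂ (ψ ∘ (φ.symm ∘ e)) 0 :=
    (((contMDiffOn_of_mem_maximalAtlas hψ).mdifferentiableOn (by simp)).comp
      (hf.mono inter_subset_left) inter_subset_right).differentiableOn.differentiableAt
        (hopen.mem_nhds h0mem)
  obtain ⟨C, hC0, hC⟩ := hd.isBigO_sub.exists_pos
  have hpole' : ∀ᶠ ζ in 𝓝[≠] (0 : ℂ), (u ∘ (φ.symm ∘ e)) ζ ≤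
      ((Real.log ‖ζ‖ + (Real.log C + c) : ℝ) : EReal) := by
    rw [eventually_nhdsWithin_iff]
    filter_upwards [hC.bound, hopen.mem_nhds h0mem] with ζ h1 h2 h3
    have hζ : 0 < ‖ζ‖ := norm_pos_iff.2 h3
    have h4 : ‖ψ ((φ.symm ∘ e) ζ) - ψ w‖ ≤ C * ‖ζ‖ := by
      rw [← hf0]; simpa using h1
    have h5 := add_le_add_left (logDist_le (mul_pos hC0 hζ) h4) (c : EReal)
    refine (hc _ h2.2).trans (h5.trans ?_)
    rw [← EReal.coe_add, EReal.coe_le_coe_iff, Real.log_mul hC0.ne' hζ.ne']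
    linarith
  have hR' : ‖φ z - φ w‖ / R < 1 := (div_lt_one hR).2 (mem_ball_iff_norm.1 hzR)
  have hζn : ‖((‖φ z - φ w‖ / R : ℝ) : ℂ)‖ = ‖φ z - φ w‖ / R := by
    rw [Complex.norm_real, Real.norm_of_nonneg (by positivity)]
  have hmain := hsub.le_log_norm (fun ζ _ => (hneg _).le) hpole'
    (z₀ := ((‖φ z - φ w‖ / R : ℝ) : ℂ)) (by rw [mem_ball_zero_iff, hζn]; exact hR')
    (by rw [← norm_pos_iff, hζn]; positivity)
  have hez : (φ.symm ∘ e) ((‖φ z - φ w‖ / R : ℝ) : ℂ) = z := by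
    have : e ((‖φ z - φ w‖ / R : ℝ) : ℂ) = φ z := by
      simp only [e, b]
      rw [smul_smul, ← Complex.ofReal_mul, div_mul_div_cancel₀ hR.ne', div_self hn.ne',
        Complex.ofReal_one, one_smul, add_sub_cancel]
    rw [Function.comp_apply, this, φ.left_inv hz]
  rw [Function.comp_apply, hez, hζn, Real.log_div hn.ne' hR.ne'] at hmain
  rw [logDist_of_ne hne, ← EReal.coe_add, ← sub_eq_add_neg]
  exact hmain

lemma isPSH_of_isStrictlyPSH {u : M → ℝ} (hu : IsStrictlyPSH n (fun z => (u z : EReal))) :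
    IsPSH n (fun z => (u z : EReal)) := by
  refine isPSHOn_of_local fun p _ => ?_
  obtain ⟨φ, hφ, hp, ε, hε, h⟩ := hu p
  have hc : ContinuousOn (fun z => ‖φ z - 0‖ ^ 2) φ.source := by
    have := φ.continuousOn
    fun_prop
  refine ⟨φ.source, φ.open_source, hp, (h.add_coe
    ((isPSHOn_normSq_chart hφ 0 subset_rfl).const_mul hε hc)
      (continuousOn_const.mul hc)).congr fun z _ => ?_⟩
  simp only [sub_zero]
  rw [← EReal.coe_sub, ← EReal.coe_add, sub_add_cancel]

theorem isPluriGreenian_of_boundedContinuousStrictlyPSH [T2Space M]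
    (h : HasBoundedContinuousStrictlyPSH n M) : IsPluriGreenian n M := by
  obtain ⟨u, huc, ⟨C, hC⟩, hu⟩ := h
  intro w
  obtain ⟨φ, hφ, hw, ε, hε, hpsh⟩ := hu w
  obtain ⟨r, hr, hball⟩ := exists_closedBall_subset_target hw
  set ρ : ℝ := r / 2 with hρ
  have hρ0 : 0 < ρ := half_pos hr
  have hρr : ρ < r := half_lt_self hr
  -- Solves `A * ε * t ^ 2 = (t / ρ) ^ 2 / 2`, so the quadratic branch of `logSq` cancels exactly.
  set A : ℝ := 1 / (2 * ε * ρ ^ 2) with hA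
  have hA0 : 0 < A := by positivity
  have hAε : ∀ t : ℝ, A * (ε * t ^ 2) = (t / ρ) ^ 2 / 2 := fun t => by
    rw [hA]; field_simp
  have hC0 : 0 ≤ C := (abs_nonneg _).trans (hC w)
  have hAu : ∀ z, A * u z ≤ A * C := fun z =>
    mul_le_mul_of_nonneg_left (abs_le.1 (hC z)).2 hA0.le
  have hAu' : ∀ z, -(A * C) ≤ A * u z := fun z => by
    have := mul_le_mul_of_nonneg_left (abs_le.1 (hC z)).1 hA0.le
    linarith
  set D₁ : Set M := φ.source ∩ φ ⁻¹' ball (φ w) r with hD₁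
  set D₂ : Set M := (φ.source ∩ φ ⁻¹' closedBall (φ w) ρ)ᶜ with hD₂
  set D₀ : Set M := φ.source ∩ φ ⁻¹' ball (φ w) ρ with hD₀
  have oD₀ : IsOpen D₀ := isOpen_chart_ball φ _ _
  have oD₁ : IsOpen D₁ := isOpen_chart_ball φ _ _
  have oD₂ : IsOpen D₂ := (isClosed_chart_closedBall φ
    ((closedBall_subset_closedBall hρr.le).trans hball)).isOpen_compl
  have hcover : ∀ z, z ∈ D₁ ∨ z ∈ D₂ := fun z => by
    by_contra hcon
    push Not at hcon
    obtain ⟨h1, h2⟩ := hcon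
    have h2 := not_not.1 h2
    exact h1 ⟨h2.1, closedBall_subset_ball hρr h2.2⟩
  have hD₀₁ : D₀ ⊆ D₁ := fun z hz => ⟨hz.1, ball_subset_ball hρr.le hz.2⟩
  classical
  let v : M → EReal := fun z =>
    if z ∈ D₁ then logSq (‖φ z - φ w‖ / ρ) + ((A * (u z - ε * ‖φ z - φ w‖ ^ 2) : ℝ) : EReal)
    else ((A * u z : ℝ) : EReal)
  have hv₁ : ∀ z ∈ D₁, v z =
      logSq (‖φ z - φ w‖ / ρ) + ((A * (u z - ε * ‖φ z - φ w‖ ^ 2) : ℝ) : EReal) :=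
    fun z hz => if_pos hz
  have hv₂ : ∀ z ∈ D₂, v z = ((A * u z : ℝ) : EReal) := fun z hz => by
    by_cases h1 : z ∈ D₁
    · have h2 : ρ ≤ ‖φ z - φ w‖ := by
        by_contra hcon
        exact hz ⟨h1.1, mem_closedBall_iff_norm.2 (not_le.1 hcon).le⟩
      rw [hv₁ z h1, logSq_of_one_le ((one_le_div hρ0).2 h2), ← EReal.coe_add, mul_sub, hAε,
        add_sub_cancel]
    · exact if_neg h1
  have hvle : ∀ z, v z ≤ ((A * C + 1 / 2 : ℝ) : EReal) := fun z => by
    by_cases h1 : z ∈ D₁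
    · rw [hv₁ z h1]
      refine EReal.add_coe_le_coe_iff.2 ((logSq_le _).trans (EReal.coe_le_coe_iff.2 ?_))
      rw [mul_sub, hAε]
      linarith [hAu z]
    · rw [show v z = _ from if_neg h1]
      exact EReal.coe_le_coe_iff.2 (by linarith [hAu z])
  have hcD₁ : ContinuousOn (fun z => u z - ε * ‖φ z - φ w‖ ^ 2) D₁ := by
    have h1 := φ.continuousOn.mono (inter_subset_left : D₁ ⊆ φ.source)
    have h2 := huc.continuousOn (s := D₁)
    fun_prop
  -- Strictness is given with `‖φ z‖ ^ 2`; moving the center to `φ w` adds a pluriharmonic term.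
  have hpsh' : IsPSHOn n (fun z => ((u z - ε * ‖φ z - φ w‖ ^ 2 : ℝ) : EReal)) D₁ := by
    have hre := isPSHOn_re_chart hφ (U := D₁) (h := fun x => (ε : ℂ) *
        (2 * innerSL ℂ (φ w) x - ((‖φ w‖ ^ 2 : ℝ) : ℂ))) (by fun_prop) inter_subset_left
    refine ((hpsh.mono inter_subset_left).add_coe hre ?_).congr fun z _ => ?_
    · have := φ.continuousOn.mono (inter_subset_left : D₁ ⊆ φ.source)
      refine Complex.continuous_re.comp_continuousOn ?_
      fun_prop
    · simp only
      rw [← EReal.coe_sub, ← EReal.coe_add, EReal.coe_eq_coe_iff, norm_sub_rev,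
        norm_sub_sq (𝕜 := ℂ), Complex.re_ofReal_mul]
      simp [-Complex.ofReal_pow]
      ring
  have hvpsh : IsPSH n v := by
    refine isPSHOn_of_local fun z _ => ?_
    rcases hcover z with hz | hz
    · exact ⟨D₁, oD₁, hz, ((isPSHOn_logSq_chart hφ (φ w) hρ0 inter_subset_left).add_coe
        (hpsh'.const_mul hA0 hcD₁) (continuousOn_const.mul hcD₁)).congr
          fun x hx => (hv₁ x hx).symm⟩
    · exact ⟨D₂, oD₂, hz, (((isPSH_of_isStrictlyPSH hu).mono (subset_univ _)).const_mul hA0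
        huc.continuousOn).congr fun x hx => (hv₂ x hx).symm⟩
  let v' : M → EReal := fun z => v z + ((-(A * C + 1) : ℝ) : EReal)
  have hv'psh : IsPSH n v' := hvpsh.add_coe (isPSHOn_const _ _) continuousOn_const
  have hv'neg : ∀ z, v' z < 0 := fun z => by
    have : v' z ≤ ((-(1 / 2) : ℝ) : EReal) := EReal.add_coe_le_coe_iff.2
      ((hvle z).trans (EReal.coe_le_coe_iff.2 (by linarith)))
    exact this.trans_lt (EReal.coe_lt_coe_iff.2 (by norm_num))
  -- The bounded remainder of the competitor after removing its logarithm on the ball of radius `ρ`;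
  -- its bounds give the pole constants.
  let β : M → ℝ := fun z =>
    -Real.log ρ + 1 / 2 + A * (u z - ε * ‖φ z - φ w‖ ^ 2) + -(A * C + 1)
  have hv'₀ : ∀ z ∈ D₀, v' z = logDist n φ z w + (β z : EReal) := fun z hz => by
    simp only [v', hv₁ z (hD₀₁ hz)]
    by_cases hzw : φ z = φ w
    · rw [logDist_of_eq hzw, hzw, sub_self, norm_zero, zero_div, logSq_of_nonpos le_rfl,
        EReal.bot_add, EReal.bot_add, EReal.bot_add]
    · have hn : 0 < ‖φ z - φ w‖ := norm_pos_iff.2 (sub_ne_zero.2 hzw)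
      rw [logDist_of_ne hzw, logSq_of_le_one (div_pos hn hρ0)
        ((div_le_one hρ0).2 (mem_ball_iff_norm.1 hz.2).le), ← EReal.coe_add, ← EReal.coe_add,
        ← EReal.coe_add, Real.log_div hn.ne' hρ0.ne']
      congr 1
      simp only [β]
      ring
  have hβ : ∀ z ∈ D₀, -Real.log ρ - 2 * (A * C) - 1 ≤ β z ∧ β z ≤ -Real.log ρ := fun z hz => by
    simp only [β]
    rw [mul_sub, hAε]
    have h1 : ‖φ z - φ w‖ / ρ ≤ 1 := (div_le_one hρ0).2 (mem_ball_iff_norm.1 hz.2).le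
    have h2 : 0 ≤ ‖φ z - φ w‖ / ρ := by positivity
    have h3 : (‖φ z - φ w‖ / ρ) ^ 2 ≤ 1 := pow_le_one₀ h2 h1
    have h4 := sq_nonneg (‖φ z - φ w‖ / ρ)
    constructor
    · linarith [hAu' z]
    · linarith [hAu z]
  have hsrc : (φ.restr D₀).source ⊆ D₀ := by
    rw [φ.restr_source, oD₀.interior_eq]
    exact inter_subset_right
  have hwsrc : w ∈ (φ.restr D₀).source := by
    rw [φ.restr_source, oD₀.interior_eq]
    exact ⟨hw, hw, mem_ball_self hρ0⟩
  have hpole : HasLogPole n v' w := by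
    refine ⟨φ.restr D₀, chart_restr_mem_holoCharts hφ oD₀, hwsrc, -Real.log ρ, fun z hz => ?_⟩
    rw [hv'₀ z (hsrc hz)]
    exact add_le_add le_rfl (EReal.coe_le_coe_iff.2 (hβ z (hsrc hz)).2)
  refine ⟨φ.restr D₀, chart_restr_mem_holoCharts hφ oD₀, hwsrc, -Real.log ρ - 2 * (A * C) - 1,
    -Real.log ρ, fun z hz => ⟨?_, ?_⟩⟩
  · calc logDist n (φ.restr D₀) z w + ((-Real.log ρ - 2 * (A * C) - 1 : ℝ) : EReal)
        ≤ logDist n φ z w + (β z : EReal) :=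
          add_le_add le_rfl (EReal.coe_le_coe_iff.2 (hβ z (hsrc hz)).1)
      _ = v' z := (hv'₀ z (hsrc hz)).symm
      _ ≤ pluricomplexGreen n z w :=
          le_iSup₂ (f := fun (u : M → EReal) _ => u z) v' ⟨hv'psh, hv'neg, hpole⟩
  · refine iSup₂_le fun f hf => ?_
    exact le_logDist_of_hasLogPole hφ hw hρ0
      ((ball_subset_closedBall.trans (closedBall_subset_closedBall hρr.le)).trans hball)
      hf.1 hf.2.1 hf.2.2 (hsrc hz).1 (hsrc hz).2

end Green

theorem mainTheorem2 (n : ℕ) (M : Type*) [TopologicalSpace M] [T2Space M]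
    [SecondCountableTopology M] [ConnectedSpace M]
    [ChartedSpace (EuclideanSpace ℂ (Fin n)) M]
    [IsManifold 𝓘(ℂ, EuclideanSpace ℂ (Fin n)) ω M] :
    (HasBoundedContinuousStrictlyPSH n M → IsPluriGreenian n M) ∧
    ((∀ w : M, ∃ v : M → EReal, Continuous v ∧ IsPSH n v ∧ (∀ z, v z < 0) ∧
        HasStrictLogPole n v w) →
      HasBoundedContinuousStrictlyPSH n M) :=
  ⟨isPluriGreenian_of_boundedContinuousStrictlyPSH, exists_boundedContinuousStrictlyPSH⟩
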